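/- **Setting.** Let $N$ agents be given, agent $i$ being a finite Markov decision process with state set $\mathcal S^i$, initial state $s_I^i$, nonempty action set $\mathcal A^i$ and transition function $\mathcal T^i:\mathcal S^i\times\mathcal A^i\to\Delta(\mathcal S^i)$. The joint game has states $\mathcal S=\prod_i\mathcal S^i$, actions $\mathcal A=\prod_i\mathcal A^i$, initial state $s_I=(s_I^i)_i$ and transitions $\mathcal T(s,a,y)=\prod_i\mathcal T^i(s^i,a^i,y^i)$. Let $\mathcal S_T,\mathcal S_A\subseteq\mathcal S$ be a target set and an avoid set; a path $s_0a_0s_1a_1\dots$ is successful if $s_M\in\mathcal S_T$ for some $M$ and $s_t\notin\mathcal S_A$ for all $t<M$. Let $\mathcal S_D$ be the set of joint states from which the supremum over all (randomized, history-dependent) joint policies of the probability of success is $0$. **Preprocessing.** Add an absorbing end state $s_\epsilon=(s_\epsilon^i)_i$ and a joint action $\epsilon=(\epsilon^i)_i$; taking $\epsilon$ leads to $s_\epsilon$ with probability $1$ (and, for each agent, $\epsilon^i$ leads to $s^i_\epsilon$). At $s_\epsilon$ and at the states of $\mathcal S_T\cup\mathcal S_D$ the only available action is $\epsilon$; at every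 other state the available actions are those of $\mathcal A$. A joint policy $\pi$ of this game is a randomized, history-dependent choice of available actions; it is stationary if it depends only on the current joint state. Under $\pi$, let $x_{s,a}$ be the expected number of times that $a$ is taken at $s$, let $x_{s^i,a^i}$ be the sum of $x_{s,a}$ over all $s,a$ whose $i$-th components are $s^i,a^i$ ($a^i\in\mathcal A^i\cup\{\epsilon^i\}$), let $\boldsymbol v^{full}$ be the probability of success, and let $l^{full}=\mathbb E[\min\{t+1: s_t\in\mathcal S_T\cup\mathcal S_D\}]$. Let $X$ be the random joint path. Let $\bar X^i$ be the path of the Markov chain generated by agent $i$ alone, starting from $s_I^i$, with the transitions $\mathcal T^i$ (extended by $s^i_\epsilon,\epsilon^i$) and the stationary policy $\pi^i(a^i\mid s^i)=x_{s^i,a^i}/\sum_{b^i\in\mathcal A^i\cup\{\epsilon^i\}}x_{s^i,b^i}$ (with $\epsilon^i$ taken at $s^i_\epsilon$, and at states where the denominator is $0$). With $H(Y)=-\sum_y\Pr(Y=y)\log\Pr(Y=y)$ put $$\bar C_\pi=\Big[\sum_{i=1}^N H(\bar X^i)\Big]-H(X).$$ **Proposition.** Assume that there is $K\ge 0$ such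 that $\sum_{a\in\mathcal A}x_{s,a}\le K$ for every joint policy $\pi$ of the preprocessed game and every $s\in\mathcal S\setminus(\mathcal S_T\cup\mathcal S_D)$. Let $\delta>0$ and $\beta>0$. Then for every joint policy $\pi$ the quantities $l^{full}$, $H(X)$ and $H(\bar X^i)$ are finite, and $\bar X^i$ has the occupancy measures $x_{s^i,a^i}$ for all $s^i\in\mathcal S^i$, $a^i\in\mathcal A^i\cup\{\epsilon^i\}$ (so that $\bar C_\pi$ is well defined); and there is a stationary joint policy that attains $$\sup_\pi\ \boldsymbol v^{full}-\delta\, l^{full}-\beta\,\bar C_\pi ,$$ the supremum being taken over all joint policies of the preprocessed game. -/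

import Mathlib

open MeasureTheory ProbabilityTheory
open scoped ENNReal NNReal

noncomputable section

/-- A finite Markov decision process: an initial state and a transition function that gives,
for each state and action, the distribution of the next state. -/
structure MDP (S A : Type*) where
  init : S
  trans : S → A → PMF S

/-- One step `s_t a_t` of a path. A path is a map `ℕ → Step S A`. -/
@[ext]
structure Step (S A : Type*) where
  state : S
  act : A

/-- State and action spaces are finite, hence discrete. -/
instance Step.instMeasurableSpace (S A : Type*) : MeasurableSpace (Step S A) := ⊤

instance Step.instDiscreteMeasurableSpace (S A : Type*) : DiscreteMeasurableSpace (Step S A) :=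
  ⟨fun _ => trivial⟩

instance Step.instFinite (S A : Type*) [Finite S] [Finite A] : Finite (Step S A) :=
  Finite.of_injective (fun x : Step S A => (x.state, x.act)) (by
    rintro ⟨s, a⟩ ⟨t, b⟩ h
    simpa using h)

/-- A randomized, history-dependent policy: `π n h s` is the distribution of the action at time `n`
when `h = s_0 a_0 … s_{n-1} a_{n-1}` has been observed and the current state is `s`. -/
abbrev Policy (S A : Type*) := (n : ℕ) → (Fin n → Step S A) → S → PMF A

/-- A stationary policy selects the action from the current state alone. -/
def Policy.ofStationary {S A : Type*} (ρ : S → PMF A) : Policy S A := fun _ _ s => ρ s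

/-- A policy only uses the available actions `avail s` at each state `s`. -/
def Policy.UsesOnly {S A : Type*} (π : Policy S A) (avail : S → Set A) : Prop :=
  ∀ n h s, (π n h s).support ⊆ avail s

namespace MDP

section General

variable {S A : Type*} [Finite S] [Finite A]

/-- The distribution of `s_0 a_0`. -/
def initStep (M : MDP S A) (π : Policy S A) : PMF (Step S A) :=
  (π 0 Fin.elim0 M.init).map fun a => ⟨M.init, a⟩

/-- The distribution of `s_{n+1} a_{n+1}` given `s_0 a_0 … s_n a_n`. -/
def nextStep (M : MDP S A) (π : Policy S A) (n : ℕ) (h : Finset.Iic n → Step S A) :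
    PMF (Step S A) :=
  (M.trans (h ⟨n, by simp⟩).state (h ⟨n, by simp⟩).act).bind fun s' =>
    (π (n + 1) (fun k => h ⟨k, by simpa using Nat.lt_succ_iff.mp k.isLt⟩) s').map fun a' => ⟨s', a'⟩

def stepKernel (M : MDP S A) (π : Policy S A) (n : ℕ) :
    Kernel (Finset.Iic n → Step S A) (Step S A) :=
  Kernel.ofFunOfCountable fun h => (M.nextStep π n h).toMeasure

instance instIsMarkovKernelStepKernel (M : MDP S A) (π : Policy S A) (n : ℕ) :
    IsMarkovKernel (M.stepKernel π n) :=
  ⟨fun h => by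
    change IsProbabilityMeasure (M.nextStep π n h).toMeasure
    infer_instance⟩

/-- The distribution on infinite paths `s_0 a_0 s_1 a_1 …` induced by the policy `π`. -/
def pathLaw (M : MDP S A) (π : Policy S A) : Measure (ℕ → Step S A) :=
  Kernel.trajMeasure (X := fun _ => Step S A) (M.initStep π).toMeasure (M.stepKernel π)

/-- The occupancy measure of `(s, a)`: the expected number of times that action `a` is taken at
state `s`. -/
def occupancy (M : MDP S A) (π : Policy S A) (s : S) (a : A) : ℝ≥0∞ :=
  ∫⁻ ξ, ∑' t : ℕ, Set.indicator {x : Step S A | x.state = s ∧ x.act = a} 1 (ξ t) ∂(M.pathLaw π)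

/-- The probability that some state of `target` is reached and no state of `avoid` is visited
before. -/
def reachAvoidProb (M : MDP S A) (π : Policy S A) (target avoid : Set S) : ℝ≥0∞ :=
  M.pathLaw π {ξ | ∃ m, (ξ m).state ∈ target ∧ ∀ t < m, (ξ t).state ∉ avoid}

/-- The expectation of `min {t + 1 | s_t ∈ goal}` (the minimum of the empty set is `∞`). -/
def expectedLength (M : MDP S A) (π : Policy S A) (goal : Set S) : ℝ≥0∞ :=
  ∫⁻ ξ, ⨅ (t : ℕ) (_ : (ξ t).state ∈ goal), ((t : ℝ≥0∞) + 1) ∂(M.pathLaw π)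

/-- The entropy `-∑ Pr(X = ξ) log Pr(X = ξ)` of the random path `X`, where `X` is a discrete random
variable: its law is concentrated on countably many paths. (This is the case when almost every path
is eventually constant.) -/
def pathEntropy (M : MDP S A) (π : Policy S A) : ℝ≥0∞ :=
  ∑' ξ : ℕ → Step S A, ENNReal.ofReal (Real.negMulLog ((M.pathLaw π).real {ξ}))

end General

/-- Adds an absorbing end state `none` and an action `none` (written `ε`) that leads to it from
every state. -/
def withEnd {S A : Type*} (M : MDP S A) : MDP (Option S) (Option A) where
  init := some M.init
  trans
    | some s, some a => (M.trans s a).map some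
    | _, _ => PMF.pure none

end MDP

/-- The product of finitely many distributions on finite sets. -/
def productPMF {N : ℕ} {S : Fin N → Type*} [∀ i, Fintype (S i)] (p : ∀ i, PMF (S i)) :
    PMF (∀ i, S i) :=
  PMF.ofFintype (fun y => ∏ i, p i (y i)) (by
    rw [← Fintype.piFinset_univ, ← Finset.prod_univ_sum]
    refine Finset.prod_eq_one fun i _ => ?_
    rw [← tsum_fintype (L := .unconditional _)]
    exact (p i).tsum_coe)

/-- `N` agents, each with its own Markov decision process, and a team reach-avoid objective on the
joint states. -/
structure TeamGame {N : ℕ} (S A : Fin N → Type*) where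
  agent : ∀ i, MDP (S i) (A i)
  target : Set (∀ i, S i)
  avoid : Set (∀ i, S i)

namespace TeamGame

variable {N : ℕ} {S A : Fin N → Type*} [∀ i, Fintype (S i)] [∀ i, Fintype (A i)]

/-- The cooperative Markov game: the agents move independently given the joint action. -/
def joint (G : TeamGame S A) : MDP (∀ i, S i) (∀ i, A i) where
  init := fun i => (G.agent i).init
  trans := fun s a => productPMF fun i => (G.agent i).trans (s i) (a i)

/-- The joint states from which the maximal reach-avoid probability is `0`. -/
def dead (G : TeamGame S A) : Set (∀ i, S i) :=
  {s | ⨆ π : Policy (∀ i, S i) (∀ i, A i),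
    ({ G.joint with init := s } : MDP _ _).reachAvoidProb π G.target G.avoid = 0}

/-- The joint states at which the game ends. -/
def terminal (G : TeamGame S A) : Set (∀ i, S i) := G.target ∪ G.dead

/-- The game with the absorbing end state `none` (`s_ε`) and the joint action `none` (`ε`). -/
def preprocessed (G : TeamGame S A) : MDP (Option (∀ i, S i)) (Option (∀ i, A i)) :=
  G.joint.withEnd

/-- In the preprocessed game, `ε` is the only action at the end state and at the states where the
game ends; the other states have the original joint actions. -/
def avail (G : TeamGame S A) : Option (∀ i, S i) → Set (Option (∀ i, A i))
  | none => {none}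
  | some s => {a | a = none ↔ s ∈ G.terminal}

/-- The policies of the preprocessed game. -/
def policies (G : TeamGame S A) : Set (Policy (Option (∀ i, S i)) (Option (∀ i, A i))) :=
  {π | π.UsesOnly G.avail}

/-- `v^full`. -/
def value (G : TeamGame S A) (π : Policy (Option (∀ i, S i)) (Option (∀ i, A i))) : ℝ≥0∞ :=
  G.preprocessed.reachAvoidProb π (some '' G.target) (some '' G.avoid)

/-- `l^full`. -/
def length (G : TeamGame S A) (π : Policy (Option (∀ i, S i)) (Option (∀ i, A i))) : ℝ≥0∞ :=
  G.preprocessed.expectedLength π (some '' G.terminal)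

open Classical in
/-- The occupancy measure `x_{s^i, a^i}` of agent `i`, the sum of the joint occupancy measures over
all states and actions of the other agents. -/
def agentOccupancy (G : TeamGame S A) (π : Policy (Option (∀ i, S i)) (Option (∀ i, A i)))
    (i : Fin N) (si : Option (S i)) (ai : Option (A i)) : ℝ≥0∞ :=
  ∑ s : Option (∀ i, S i), ∑ a : Option (∀ i, A i),
    if s.map (fun s => s i) = si ∧ a.map (fun a => a i) = ai then
      G.preprocessed.occupancy π s a else 0

open Classical in
/-- The stationary policy of agent `i` whose action probabilities at `s^i` are proportional to
`x_{s^i, a^i}`. (It takes `ε` at the end state and at states that the agent never visits.) -/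
def agentPolicy (G : TeamGame S A) (π : Policy (Option (∀ i, S i)) (Option (∀ i, A i)))
    (i : Fin N) (si : Option (S i)) : PMF (Option (A i)) :=
  if h : ∑' ai, G.agentOccupancy π i si ai ≠ 0 ∧ ∑' ai, G.agentOccupancy π i si ai ≠ ∞ then
    PMF.normalize (G.agentOccupancy π i si) h.1 h.2
  else PMF.pure none

/-- `H(X)`, the entropy of the joint path until the end of the game. -/
def jointEntropy (G : TeamGame S A) (π : Policy (Option (∀ i, S i)) (Option (∀ i, A i))) : ℝ≥0∞ :=
  G.preprocessed.pathEntropy π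

/-- The occupancy measure of the stationary process `X̄^i`, which agent `i` generates on its own
with the policy `agentPolicy`. -/
def stationaryOccupancy (G : TeamGame S A) (π : Policy (Option (∀ i, S i)) (Option (∀ i, A i)))
    (i : Fin N) (si : Option (S i)) (ai : Option (A i)) : ℝ≥0∞ :=
  (G.agent i).withEnd.occupancy (Policy.ofStationary (G.agentPolicy π i)) si ai

/-- `H(X̄^i)`, the entropy of the stationary process `X̄^i` until the end of the game. -/
def stationaryEntropy (G : TeamGame S A) (π : Policy (Option (∀ i, S i)) (Option (∀ i, A i)))
    (i : Fin N) : ℝ≥0∞ :=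
  (G.agent i).withEnd.pathEntropy (Policy.ofStationary (G.agentPolicy π i))

/-- `C̄_π = ∑ i, H(X̄^i) - H(X)`. -/
def totalCorrelationBound (G : TeamGame S A)
    (π : Policy (Option (∀ i, S i)) (Option (∀ i, A i))) : ℝ :=
  ∑ i, (G.stationaryEntropy π i).toReal - (G.jointEntropy π).toReal

/-- `v^full - δ l^full - β C̄_π`. -/
def objective (G : TeamGame S A) (δ β : ℝ)
    (π : Policy (Option (∀ i, S i)) (Option (∀ i, A i))) : ℝ :=
  (G.value π).toReal - δ * (G.length π).toReal - β * G.totalCorrelationBound π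

end TeamGame

end

set_option linter.unusedSectionVars false

noncomputable section

/-! ### Path law, time marginals and occupancy measures. -/

/-- A step is a pair of a state and an action. -/
def Step.equivProd (S A : Type*) : Step S A ≃ S × A where
  toFun x := (x.state, x.act)
  invFun p := ⟨p.1, p.2⟩
  left_inv _ := rfl
  right_inv _ := rfl

theorem Step.tsum_eq {S A : Type*} (f : Step S A → ℝ≥0∞) :
    ∑' x, f x = ∑' (s : S) (a : A), f ⟨s, a⟩ := by
  rw [← (Step.equivProd S A).symm.tsum_eq, ENNReal.tsum_prod']
  rfl

namespace MDP

variable {S A : Type*} [Finite S] [Finite A] (M : MDP S A) (π : Policy S A)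

instance instIsProbabilityMeasurePathLaw : IsProbabilityMeasure (M.pathLaw π) := by
  unfold pathLaw; infer_instance

theorem initStep_apply (s : S) (a : A) [Decidable (s = M.init)] :
    M.initStep π ⟨s, a⟩ = if s = M.init then π 0 Fin.elim0 M.init a else 0 := by
  classical
  rw [initStep, PMF.map_apply]
  by_cases h : s = M.init
  · subst h
    simp only [Step.mk.injEq, true_and, if_true]
    rw [tsum_eq_single a (fun b hb => by simp [hb.symm])]
    simp
  · simp [h]

theorem nextStep_apply (n : ℕ) (h : Finset.Iic n → Step S A) (s : S) (a : A) :
    M.nextStep π n h ⟨s, a⟩ =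
      M.trans (h ⟨n, by simp⟩).state (h ⟨n, by simp⟩).act s *
        π (n + 1) (fun k => h ⟨k, by simpa using Nat.lt_succ_iff.mp k.isLt⟩) s a := by
  classical
  rw [nextStep, PMF.bind_apply, tsum_eq_single s]
  · rw [PMF.map_apply, tsum_eq_single a (fun b hb => by simp [hb.symm])]
    simp
  · intro y hy
    rw [PMF.map_apply]
    simp [hy.symm]

theorem map_eval_zero_pathLaw :
    (M.pathLaw π).map (fun ξ => ξ 0) = (M.initStep π).toMeasure := by
  have h0 : (fun ξ : ℕ → Step S A => ξ 0) =
      (fun h : Finset.Iic 0 → Step S A => h ⟨0, by simp⟩) ∘ Preorder.frestrictLe 0 := rfl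
  rw [h0, ← Measure.map_map (by fun_prop) (by fun_prop), pathLaw, Kernel.trajMeasure,
    Measure.map_comp _ _ (by fun_prop), Kernel.traj_map_frestrictLe, Kernel.partialTraj_self,
    Measure.id_comp, Measure.map_map (by fun_prop) (by fun_prop)]
  have h1 : (fun h : Finset.Iic 0 → Step S A => h ⟨0, by simp⟩) ∘
      (MeasurableEquiv.piUnique fun _ : Finset.Iic 0 => Step S A).symm = id := rfl
  exact (congrArg (fun g => Measure.map g _) h1).trans Measure.map_id

theorem lintegral_pathLaw_zero (f : Step S A → ℝ≥0∞) :
    ∫⁻ ξ, f (ξ 0) ∂(M.pathLaw π) = ∑' a, π 0 Fin.elim0 M.init a * f ⟨M.init, a⟩ := by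
  classical
  rw [← lintegral_map (μ := M.pathLaw π) (f := f) (g := fun ξ => ξ 0) (measurable_of_countable f)
    (by fun_prop), map_eval_zero_pathLaw, lintegral_countable', Step.tsum_eq,
    tsum_eq_single M.init]
  · refine tsum_congr fun a => ?_
    rw [PMF.toMeasure_apply_singleton _ _ (by measurability), initStep_apply, if_pos rfl, mul_comm]
  · intro s hs
    simp [PMF.toMeasure_apply_singleton, initStep_apply, hs]

/-- The one-step disintegration of the path law. -/
theorem lintegral_pathLaw_succ (n : ℕ) (f : (Finset.Iic n → Step S A) → Step S A → ℝ≥0∞) :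
    ∫⁻ ξ, f (Preorder.frestrictLe n ξ) (ξ (n + 1)) ∂(M.pathLaw π) =
      ∫⁻ ξ, ∑' y, M.trans (ξ n).state (ξ n).act y *
        ∑' a, π (n + 1) (fun k => ξ k) y a * f (Preorder.frestrictLe n ξ) ⟨y, a⟩
        ∂(M.pathLaw π) := by
  have h1 : ∫⁻ ξ, f (Preorder.frestrictLe n ξ) (ξ (n + 1)) ∂(M.pathLaw π) =
      ∫⁻ p, f p.1 p.2 ∂((M.pathLaw π).map fun ξ => (Preorder.frestrictLe n ξ, ξ (n + 1))) := by
    rw [lintegral_map (measurable_of_countable _) (by fun_prop)]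
  rw [h1, pathLaw, ← Kernel.map_frestrictLe_trajMeasure_compProd_eq_map_trajMeasure,
    Measure.lintegral_compProd (measurable_of_countable _),
    lintegral_map (measurable_of_countable _) (by fun_prop)]
  refine lintegral_congr fun ξ => ?_
  rw [lintegral_countable', Step.tsum_eq]
  refine tsum_congr fun y => ?_
  rw [← ENNReal.tsum_mul_left]
  refine tsum_congr fun a => ?_
  change _ * (M.nextStep π n (Preorder.frestrictLe n ξ)).toMeasure {_} = _
  rw [PMF.toMeasure_apply_singleton _ _ (by measurability), nextStep_apply]
  simp only [Preorder.frestrictLe_apply]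
  ring

/-- The probability of being at `s` at time `t` and taking action `a`. -/
def marginal (t : ℕ) (s : S) (a : A) : ℝ≥0∞ :=
  M.pathLaw π {ξ | (ξ t).state = s ∧ (ξ t).act = a}

theorem lintegral_eval (t : ℕ) (f : Step S A → ℝ≥0∞) :
    ∫⁻ ξ, f (ξ t) ∂(M.pathLaw π) = ∑' (s : S) (a : A), M.marginal π t s a * f ⟨s, a⟩ := by
  rw [← lintegral_map (μ := M.pathLaw π) (f := f) (g := fun ξ => ξ t) (measurable_of_countable f)
    (by fun_prop), lintegral_countable', Step.tsum_eq]
  refine tsum_congr fun s => tsum_congr fun a => ?_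
  rw [Measure.map_apply (by fun_prop) (by measurability), mul_comm]
  congr 2
  ext ξ
  simp [Step.ext_iff]

theorem measurableSet_eval (t : ℕ) (p : Step S A → Prop) :
    MeasurableSet {ξ : ℕ → Step S A | p (ξ t)} :=
  (measurable_pi_apply t) (MeasurableSet.of_discrete (s := {x | p x}))

theorem occupancy_eq_tsum_marginal (s : S) (a : A) :
    M.occupancy π s a = ∑' t, M.marginal π t s a := by
  rw [occupancy, lintegral_tsum]
  · refine tsum_congr fun t => ?_
    rw [marginal, ← lintegral_indicator_one (measurableSet_eval t fun x => x.state = s ∧ x.act = a)]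
    rfl
  · intro t
    exact ((measurable_of_countable (Set.indicator {x : Step S A | x.state = s ∧ x.act = a} 1)).comp
      (measurable_pi_apply t)).aemeasurable

/-- Expected additive path functionals depend on the policy through its occupancy measure alone.
This reduces value, length and cross entropy to finitely many numbers. -/
theorem lintegral_tsum_eval (f : Step S A → ℝ≥0∞) :
    ∫⁻ ξ, ∑' t, f (ξ t) ∂(M.pathLaw π) = ∑' (s : S) (a : A), M.occupancy π s a * f ⟨s, a⟩ := by
  rw [lintegral_tsum (f := fun (t : ℕ) (ξ : ℕ → Step S A) => f (ξ t))
    fun t => ((measurable_of_countable f).comp (measurable_pi_apply t)).aemeasurable]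
  simp_rw [lintegral_eval, occupancy_eq_tsum_marginal, ← ENNReal.tsum_mul_right]
  rw [ENNReal.tsum_comm]
  exact tsum_congr fun s => ENNReal.tsum_comm

/-- The expected value of a function of a step and the next state. -/
theorem lintegral_eval_succ (t : ℕ) (f : Step S A → S → ℝ≥0∞) :
    ∫⁻ ξ, f (ξ t) (ξ (t + 1)).state ∂(M.pathLaw π) =
      ∑' (s : S) (a : A), M.marginal π t s a * ∑' y, M.trans s a y * f ⟨s, a⟩ y := by
  have := M.lintegral_pathLaw_succ π t (fun h x => f (h ⟨t, by simp⟩) x.state)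
  simp only [Preorder.frestrictLe_apply] at this
  rw [this, ← M.lintegral_eval π t fun x => ∑' y, M.trans x.state x.act y * f x y]
  refine lintegral_congr fun ξ => tsum_congr fun y => ?_
  rw [ENNReal.tsum_mul_right, PMF.tsum_coe, one_mul]

theorem lintegral_tsum_eval_succ (f : Step S A → S → ℝ≥0∞) :
    ∫⁻ ξ, ∑' t, f (ξ t) (ξ (t + 1)).state ∂(M.pathLaw π) =
      ∑' (s : S) (a : A), M.occupancy π s a * ∑' y, M.trans s a y * f ⟨s, a⟩ y := by
  have h : Measurable fun p : Step S A × Step S A => f p.1 p.2.state := measurable_of_countable _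
  rw [lintegral_tsum (f := fun (t : ℕ) (ξ : ℕ → Step S A) => f (ξ t) (ξ (t + 1)).state)
    fun t => (h.comp (g := fun p : Step S A × Step S A => f p.1 p.2.state)
      (f := fun ξ : ℕ → Step S A => (ξ t, ξ (t + 1)))
      ((measurable_pi_apply t).prodMk (measurable_pi_apply (t + 1)))).aemeasurable]
  simp_rw [lintegral_eval_succ, occupancy_eq_tsum_marginal]
  simp_rw [← ENNReal.tsum_mul_right]
  rw [ENNReal.tsum_comm]
  exact tsum_congr fun s => ENNReal.tsum_comm

open Classical in
theorem tsum_marginal_zero (s : S) :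
    ∑' a, M.marginal π 0 s a = if s = M.init then 1 else 0 := by
  have h := M.lintegral_pathLaw_zero π fun x => if x.state = s then 1 else 0
  rw [M.lintegral_eval π 0 fun x => if x.state = s then 1 else 0,
    tsum_eq_single s (fun y hy => by simp [hy])] at h
  have h2 : ∑' a, M.marginal π 0 s a =
      ∑' a, π 0 Fin.elim0 M.init a * if M.init = s then 1 else 0 := by
    simpa using h
  rw [h2, ENNReal.tsum_mul_right, PMF.tsum_coe, one_mul]
  simp [eq_comm]

theorem tsum_marginal_succ (t : ℕ) (y : S) :
    ∑' b, M.marginal π (t + 1) y b =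
      ∑' (s : S) (a : A), M.marginal π t s a * M.trans s a y := by
  classical
  have h := M.lintegral_eval_succ π t fun _ x => if x = y then 1 else 0
  rw [M.lintegral_eval π (t + 1) (fun x => if x.state = y then 1 else 0),
    tsum_eq_single y (fun y hy => by simp [hy])] at h
  simpa using h

open Classical in
/-- The flow equation for the occupancy measure. -/
theorem tsum_occupancy (y : S) :
    ∑' b, M.occupancy π y b =
      (if y = M.init then 1 else 0) + ∑' (s : S) (a : A), M.occupancy π s a * M.trans s a y := by
  have h1 (s : S) : ∑' a, M.occupancy π s a * M.trans s a y =
      ∑' (t : ℕ) (a : A), M.marginal π t s a * M.trans s a y := by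
    simp_rw [occupancy_eq_tsum_marginal, ← ENNReal.tsum_mul_right]
    exact ENNReal.tsum_comm
  have h2 : ∑' b, M.occupancy π y b = ∑' (t : ℕ) (b : A), M.marginal π t y b := by
    simp_rw [occupancy_eq_tsum_marginal]
    exact ENNReal.tsum_comm
  rw [h2, tsum_eq_zero_add' ENNReal.summable, tsum_marginal_zero, tsum_congr h1,
    tsum_congr fun t => M.tsum_marginal_succ π t y]
  congr 1
  exact ENNReal.tsum_comm

theorem marginal_le_occupancy (t : ℕ) (s : S) (a : A) :
    M.marginal π t s a ≤ M.occupancy π s a := by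
  rw [occupancy_eq_tsum_marginal]
  exact ENNReal.le_tsum t

theorem marginal_eq_zero {s : S} {a : A} (h : ∀ n k, π n k s a = 0) (t : ℕ) :
    M.marginal π t s a = 0 := by
  classical
  have key : ∫⁻ ξ, (if (ξ t).state = s ∧ (ξ t).act = a then 1 else 0) ∂(M.pathLaw π) = 0 := by
    cases t with
    | zero =>
      rw [M.lintegral_pathLaw_zero π fun x => if x.state = s ∧ x.act = a then 1 else 0]
      refine ENNReal.tsum_eq_zero.2 fun b => ?_
      by_cases hb : M.init = s ∧ b = a
      · rw [hb.1, hb.2, h]; simp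
      · simp [hb]
    | succ t =>
      rw [M.lintegral_pathLaw_succ π t fun _ x => if x.state = s ∧ x.act = a then 1 else 0]
      refine (lintegral_congr fun ξ => ?_).trans lintegral_zero
      refine ENNReal.tsum_eq_zero.2 fun y => ?_
      rw [ENNReal.tsum_eq_zero.2, mul_zero]
      intro b
      by_cases hb : y = s ∧ b = a
      · rw [hb.1, hb.2, h]; simp
      · simp [hb]
  rw [M.lintegral_eval π t fun x => if x.state = s ∧ x.act = a then 1 else 0] at key
  simpa using ENNReal.tsum_eq_zero.1 (ENNReal.tsum_eq_zero.1 key s) a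

theorem occupancy_eq_zero {s : S} {a : A} (h : ∀ n k, π n k s a = 0) :
    M.occupancy π s a = 0 := by
  rw [occupancy_eq_tsum_marginal]
  exact ENNReal.tsum_eq_zero.2 (M.marginal_eq_zero π h)

/-- At each time the action is drawn given the current state alone, so the joint marginal factors.
Summing over time gives the same factorization of the occupancy measure. -/
theorem marginal_ofStationary (ρ : S → PMF A) (t : ℕ) (s : S) (a : A) :
    M.marginal (.ofStationary ρ) t s a =
      (∑' b, M.marginal (.ofStationary ρ) t s b) * ρ s a := by
  classical
  have key (c : A) : ∫⁻ ξ, (if (ξ t).state = s ∧ (ξ t).act = c then 1 else 0)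
        ∂(M.pathLaw (.ofStationary ρ)) =
      (∫⁻ ξ, (if (ξ t).state = s then 1 else 0) ∂(M.pathLaw (.ofStationary ρ))) * ρ s c := by
    cases t with
    | zero =>
      rw [M.lintegral_pathLaw_zero _ fun x => if x.state = s ∧ x.act = c then 1 else 0,
        M.lintegral_pathLaw_zero _ fun x => if x.state = s then 1 else 0,
        tsum_eq_single c (fun b hb => by simp [hb])]
      by_cases hs : M.init = s
      · simp [hs, Policy.ofStationary]
      · simp [hs]
    | succ t =>
      rw [M.lintegral_pathLaw_succ _ t fun _ x => if x.state = s ∧ x.act = c then 1 else 0,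
        M.lintegral_pathLaw_succ _ t fun _ x => if x.state = s then 1 else 0,
        ← lintegral_mul_const' _ _ (PMF.apply_ne_top _ _)]
      refine lintegral_congr fun ξ => ?_
      rw [← ENNReal.tsum_mul_right]
      refine tsum_congr fun y => ?_
      rw [
        tsum_eq_single c (fun b hb => by simp [hb])]
      by_cases hs : y = s
      · simp [hs, Policy.ofStationary]
      · simp [hs]
  have h1 := key a
  rw [M.lintegral_eval _ t fun x => if x.state = s ∧ x.act = a then 1 else 0,
    M.lintegral_eval _ t fun x => if x.state = s then 1 else 0,
    tsum_eq_single s (fun y hy => by simp [hy]),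
    tsum_eq_single s (fun y hy => by simp [hy])] at h1
  simpa using h1

theorem occupancy_ofStationary (ρ : S → PMF A) (s : S) (a : A) :
    M.occupancy (.ofStationary ρ) s a =
      (∑' b, M.occupancy (.ofStationary ρ) s b) * ρ s a := by
  simp_rw [occupancy_eq_tsum_marginal]
  rw [ENNReal.tsum_comm, ← ENNReal.tsum_mul_right]
  exact tsum_congr fun t => M.marginal_ofStationary ρ t s a

end MDP

/-! ### Sums of extended nonnegative reals and almost sure properties of paths. -/

theorem ENNReal.tsum_option {α : Type*} (f : Option α → ℝ≥0∞) :
    ∑' o, f o = f none + ∑' a, f (some a) := by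
  classical
  rw [ENNReal.summable.tsum_eq_add_tsum_ite' none]
  congr 1
  rw [← (Option.some_injective α).tsum_eq]
  · simp
  · intro o ho
    cases o with
    | none => simp at ho
    | some a => exact ⟨a, rfl⟩

/-- Turns a global balance of finite mass into pointwise equalities; every closed-set argument below
rests on it. -/
theorem ENNReal.eq_of_le_of_tsum_le {α : Type*} {f g : α → ℝ≥0∞} (h : ∀ a, f a ≤ g a)
    (hf : ∑' a, f a ≠ ∞) (hs : ∑' a, g a ≤ ∑' a, f a) (a : α) : f a = g a := by
  by_contra hne
  exact (ENNReal.tsum_lt_tsum hf h (lt_of_le_of_ne (h a) hne)).not_ge hs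

namespace MDP

section AlmostSure

variable {S A : Type*} [Finite S] [Finite A] (M : MDP S A) (π : Policy S A)

theorem ae_init : ∀ᵐ ξ ∂(M.pathLaw π), (ξ 0).state = M.init := by
  classical
  rw [ae_iff, ← lintegral_indicator_one
    (measurableSet_eval 0 fun x => ¬ x.state = M.init)]
  have h := M.lintegral_pathLaw_zero π fun x => if x.state = M.init then 0 else 1
  simp only [if_true, mul_zero, tsum_zero] at h
  rw [← h]
  refine lintegral_congr fun ξ => ?_
  by_cases h : (ξ 0).state = M.init <;> simp [h]

/-- Lets constraints on the policy, stated as vanishing occupancies, be used path by path. -/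
theorem ae_occupancy_ne_zero :
    ∀ᵐ ξ ∂(M.pathLaw π), ∀ t, M.occupancy π (ξ t).state (ξ t).act ≠ 0 := by
  classical
  refine ae_all_iff.2 fun t => ?_
  rw [ae_iff, ← lintegral_indicator_one
    (measurableSet_eval t fun x => ¬ M.occupancy π x.state x.act ≠ 0)]
  have h := M.lintegral_eval π t fun x => if M.occupancy π x.state x.act ≠ 0 then 0 else 1
  refine Eq.trans (lintegral_congr fun ξ => ?_) (h.trans ?_)
  · by_cases h : M.occupancy π (ξ t).state (ξ t).act = 0 <;> simp [h]
  · refine ENNReal.tsum_eq_zero.2 fun s => ENNReal.tsum_eq_zero.2 fun a => ?_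
    by_cases h : M.occupancy π s a = 0
    · have := M.marginal_le_occupancy π t s a
      rw [h] at this
      simp [le_antisymm this zero_le]
    · simp [h]

theorem ae_trans_ne_zero :
    ∀ᵐ ξ ∂(M.pathLaw π), ∀ t, M.trans (ξ t).state (ξ t).act (ξ (t + 1)).state ≠ 0 := by
  classical
  refine ae_all_iff.2 fun t => ?_
  have hm : Measurable fun ξ : ℕ → Step S A => (ξ t, ξ (t + 1)) := by fun_prop
  have hs : MeasurableSet {ξ : ℕ → Step S A |
      ¬ M.trans (ξ t).state (ξ t).act (ξ (t + 1)).state ≠ 0} :=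
    hm (MeasurableSet.of_discrete (s := {p : Step S A × Step S A |
      ¬ M.trans p.1.state p.1.act p.2.state ≠ 0}))
  rw [ae_iff, ← lintegral_indicator_one hs]
  have h := M.lintegral_eval_succ π t fun x y => if M.trans x.state x.act y ≠ 0 then 0 else 1
  refine Eq.trans (lintegral_congr fun ξ => ?_) (h.trans ?_)
  · by_cases h : M.trans (ξ t).state (ξ t).act (ξ (t + 1)).state = 0 <;> simp [h]
  · refine ENNReal.tsum_eq_zero.2 fun s => ENNReal.tsum_eq_zero.2 fun a => ?_
    rw [ENNReal.tsum_eq_zero.2, mul_zero]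
    intro y
    by_cases h : M.trans s a y = 0 <;> simp [h]

end AlmostSure

/-! ### Flows, and when a flow is an occupancy measure. -/

variable {S A : Type*} [Finite S] [Finite A] (M : MDP S A)

@[simp]
theorem withEnd_init : M.withEnd.init = some M.init := rfl

@[simp]
theorem withEnd_trans_none (b : Option A) : M.withEnd.trans none b = PMF.pure none := rfl

@[simp]
theorem withEnd_trans_some_none (s : S) : M.withEnd.trans (some s) none = PMF.pure none := rfl

theorem withEnd_trans_some_some (s y : S) (a : A) :
    M.withEnd.trans (some s) (some a) (some y) = M.trans s a y := by
  classical
  change (M.trans s a).map some (some y) = _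
  rw [PMF.map_apply, tsum_eq_single y (fun b hb => by simp [hb.symm])]
  simp

theorem withEnd_trans_some_some_none (s : S) (a : A) :
    M.withEnd.trans (some s) (some a) none = 0 := by
  change (M.trans s a).map some none = _
  rw [PMF.map_apply]
  simp

/-- The flow equation for a nonnegative function on state-action pairs. -/
def IsFlow (x : S → Option A → ℝ≥0∞) : Prop :=
  ∀ y, ∑' b, x y b = ({M.init} : Set S).indicator 1 y +
    ∑' (s : S) (b : Option A), x s b * M.withEnd.trans (some s) b (some y)

/-- The end state can be dropped from the balance: its occupancy may be infinite, but it sends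
nothing back to the states `some y`. -/
theorem isFlow_occupancy (π : Policy (Option S) (Option A)) :
    M.IsFlow fun s b => M.withEnd.occupancy π (some s) b := by
  classical
  intro y
  rw [tsum_occupancy, ENNReal.tsum_option]
  simp [Set.indicator_apply]

theorem tsum_marginal_succ_some (π : Policy (Option S) (Option A)) (t : ℕ) (y : S) :
    ∑' b, M.withEnd.marginal π (t + 1) (some y) b =
      ∑' (s : S) (b : Option A), M.withEnd.marginal π t (some s) b *
        M.withEnd.trans (some s) b (some y) := by
  rw [tsum_marginal_succ, ENNReal.tsum_option]
  simp

theorem tsum_marginal_zero_some (π : Policy (Option S) (Option A)) (y : S) :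
    ∑' b, M.withEnd.marginal π 0 (some y) b = ({M.init} : Set S).indicator 1 y := by
  classical
  rw [tsum_marginal_zero]
  simp [Set.indicator_apply]

/-- A set of states without inflow is never visited. -/
theorem occupancy_eq_zero_of_no_inflow (π : Policy (Option S) (Option A)) {D : Set S}
    (h0 : M.init ∉ D) (hD : ∀ s ∉ D, ∀ b, ∀ y ∈ D,
      M.withEnd.occupancy π (some s) b * M.withEnd.trans (some s) b (some y) = 0) :
    ∀ s ∈ D, ∀ b, M.withEnd.occupancy π (some s) b = 0 := by
  have key (t : ℕ) : ∀ s ∈ D, ∀ b, M.withEnd.marginal π t (some s) b = 0 := by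
    induction t with
    | zero =>
      intro s hs
      refine ENNReal.tsum_eq_zero.1 ?_
      rw [tsum_marginal_zero_some, Set.indicator_of_notMem]
      rintro rfl
      exact h0 hs
    | succ t ih =>
      intro y hy
      refine ENNReal.tsum_eq_zero.1 ?_
      rw [tsum_marginal_succ_some]
      refine ENNReal.tsum_eq_zero.2 fun s => ENNReal.tsum_eq_zero.2 fun b => ?_
      by_cases hs : s ∈ D
      · rw [ih s hs, zero_mul]
      · refine le_antisymm ?_ zero_le
        rw [← hD s hs b y hy]
        gcongr
        exact M.withEnd.marginal_le_occupancy π t _ _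
  intro s hs b
  rw [occupancy_eq_tsum_marginal]
  exact ENNReal.tsum_eq_zero.2 fun t => key t s hs b

variable {M}

/-- A finite flow has no inflow into a set of states that it does not leave. -/
theorem IsFlow.no_inflow {x : S → Option A → ℝ≥0∞} (hx : M.IsFlow x)
    (hfin : ∑' (s : S) (b : Option A), x s b ≠ ∞) {D : Set S}
    (hD : ∀ s ∈ D, ∀ b, x s b ≠ 0 →
      ∑' y, D.indicator (fun y => M.withEnd.trans (some s) b (some y)) y = 1) :
    M.init ∉ D ∧ ∀ s ∉ D, ∀ b, ∀ y ∈ D, x s b * M.withEnd.trans (some s) b (some y) = 0 := by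
  set g : S → ℝ≥0∞ := fun s => ∑' b, x s b *
    ∑' y, D.indicator (fun y => M.withEnd.trans (some s) b (some y)) y with hg
  set f : S → ℝ≥0∞ := fun s => D.indicator (fun s => ∑' b, x s b) s with hf
  have hffin : ∑' s, f s ≠ ∞ := by
    refine ne_top_of_le_ne_top hfin (ENNReal.tsum_le_tsum fun s => ?_)
    exact Set.indicator_le_self _ _ _
  have hsum : ∑' s, f s = D.indicator 1 M.init + ∑' s, g s := by
    have h1 (y : S) : f y = D.indicator (({M.init} : Set S).indicator 1) y +
        ∑' (s : S) (b : Option A), x s b *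
          D.indicator (fun y => M.withEnd.trans (some s) b (some y)) y := by
      by_cases hy : y ∈ D
      · simp only [hf, Set.indicator_of_mem hy]
        exact hx y
      · simp [hf, hy]
    rw [tsum_congr h1, ENNReal.tsum_add]
    congr 1
    · rw [tsum_eq_single M.init]
      · by_cases h : M.init ∈ D <;> simp [h]
      · intro y hy
        by_cases h : y ∈ D <;> simp [h, hy]
    · rw [ENNReal.tsum_comm]
      refine tsum_congr fun s => ?_
      rw [ENNReal.tsum_comm]
      exact tsum_congr fun b => ENNReal.tsum_mul_left
  -- In `D` all mass that leaves a state returns to `D`. As `hsum` gives the reverse comparison of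
  -- the finite totals, `f = g`, which leaves no room for a source in `D` or for inflow from
  -- outside.
  have hfg (s : S) : f s ≤ g s := by
    by_cases hs : s ∈ D
    · simp only [hf, hg, Set.indicator_of_mem hs]
      refine ENNReal.tsum_le_tsum fun b => ?_
      by_cases hb : x s b = 0
      · simp [hb]
      · rw [hD s hs b hb, mul_one]
    · simp [hf, hs]
  have hgf : ∑' s, g s ≤ ∑' s, f s := hsum ▸ le_add_self
  have heq := ENNReal.eq_of_le_of_tsum_le hfg hffin hgf
  constructor
  · intro h
    rw [tsum_congr heq, Set.indicator_of_mem h, Pi.one_apply] at hsum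
    rw [tsum_congr heq] at hffin
    have : (0 : ℝ≥0∞) = 1 := (ENNReal.add_left_inj hffin).1 (by simpa using hsum)
    simp at this
  · intro s hs b y hy
    have h1 := heq s
    simp only [hf, Set.indicator_of_notMem hs] at h1
    have h2 := ENNReal.tsum_eq_zero.1 h1.symm b
    rw [mul_eq_zero, ENNReal.tsum_eq_zero] at h2
    rw [mul_eq_zero]
    refine h2.imp_right fun h => ?_
    simpa [Set.indicator_of_mem hy] using h y

/-- The occupancy measure of a stationary policy is the smallest flow with its action
probabilities. -/
theorem IsFlow.occupancy_le {x : S → Option A → ℝ≥0∞} (hx : M.IsFlow x)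
    {ρ : Option S → PMF (Option A)} (hρ : ∀ s b, x s b = (∑' c, x s c) * ρ (some s) b)
    (s : S) (b : Option A) : M.withEnd.occupancy (.ofStationary ρ) (some s) b ≤ x s b := by
  have key (n : ℕ) : ∀ s b, ∑ t ∈ Finset.range n,
      M.withEnd.marginal (.ofStationary ρ) t (some s) b ≤ x s b := by
    induction n with
    | zero => simp
    | succ n ih =>
      intro y b
      rw [hρ, Finset.sum_congr rfl fun t _ => M.withEnd.marginal_ofStationary ρ t (some y) b,
        ← Finset.sum_mul]
      gcongr
      -- Time `0` matches the source term of the flow equation; the later times are one transition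
      -- applied to the sums up to `n`, where `ih` applies.
      rw [Finset.sum_range_succ', hx, add_comm, tsum_marginal_zero_some]
      gcongr
      simp_rw [tsum_marginal_succ_some]
      rw [← Summable.tsum_finsetSum fun _ _ => ENNReal.summable]
      refine ENNReal.tsum_le_tsum fun s => ?_
      rw [← Summable.tsum_finsetSum fun _ _ => ENNReal.summable]
      refine ENNReal.tsum_le_tsum fun b => ?_
      rw [← Finset.sum_mul]
      gcongr
      exact ih s b
  rw [occupancy_eq_tsum_marginal, ENNReal.tsum_eq_iSup_nat]
  exact iSup_le fun n => key n s b

/-- A finite flow with the action probabilities of a stationary policy is the occupancy measure of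
this policy if it vanishes on isolated closed sets of states. -/
theorem IsFlow.occupancy_eq {x : S → Option A → ℝ≥0∞} (hx : M.IsFlow x)
    (hfin : ∑' (s : S) (b : Option A), x s b ≠ ∞)
    {ρ : Option S → PMF (Option A)} (hρ : ∀ s b, x s b = (∑' c, x s c) * ρ (some s) b)
    (hD : ∀ D : Set S, (∀ s ∈ D, ∀ b, ρ (some s) b ≠ 0 →
        ∑' y, D.indicator (fun y => M.withEnd.trans (some s) b (some y)) y = 1) →
      M.init ∉ D →
      (∀ s ∉ D, ∀ b, ∀ y ∈ D, x s b * M.withEnd.trans (some s) b (some y) = 0) →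
      ∀ s ∈ D, ∀ b, x s b = 0)
    (s : S) (b : Option A) : M.withEnd.occupancy (.ofStationary ρ) (some s) b = x s b := by
  set z : S → Option A → ℝ≥0∞ := fun s b => M.withEnd.occupancy (.ofStationary ρ) (some s) b with hz
  have hzx : ∀ s b, z s b ≤ x s b := hx.occupancy_le hρ
  have hzflow : M.IsFlow z := M.isFlow_occupancy _
  have hzρ (s : S) (b : Option A) : z s b = (∑' c, z s c) * ρ (some s) b :=
    M.withEnd.occupancy_ofStationary ρ _ _
  set X : S → ℝ≥0∞ := fun s => ∑' b, x s b with hX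
  set Z : S → ℝ≥0∞ := fun s => ∑' b, z s b with hZ
  have hZX (s : S) : Z s ≤ X s := ENNReal.tsum_le_tsum (hzx s)
  have hXfin (s : S) : X s ≠ ∞ := ENNReal.ne_top_of_tsum_ne_top hfin s
  have hZfin (s : S) : Z s ≠ ∞ := ne_top_of_le_ne_top (hXfin s) (hZX s)
  -- The defect between flow and occupancy. The sources cancel, so `d` is an invariant measure of
  -- the chain `P`, and its support is closed under `ρ`.
  set d : S → ℝ≥0∞ := fun s => X s - Z s with hd
  have hdX (s : S) : X s = Z s + d s := (add_tsub_cancel_of_le (hZX s)).symm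
  have hdfin : ∑' s, d s ≠ ∞ :=
    ne_top_of_le_ne_top hfin (ENNReal.tsum_le_tsum fun s => tsub_le_self)
  set P : S → S → ℝ≥0∞ := fun s y =>
    ∑' b, ρ (some s) b * M.withEnd.trans (some s) b (some y) with hP
  have hXP (y : S) : X y = ({M.init} : Set S).indicator 1 y + ∑' s, X s * P s y := by
    refine (hx y).trans ?_
    congr 1
    refine tsum_congr fun s => ?_
    rw [hP, ← ENNReal.tsum_mul_left]
    refine tsum_congr fun b => ?_
    rw [hρ s b, mul_assoc]
  have hZP (y : S) : Z y = ({M.init} : Set S).indicator 1 y + ∑' s, Z s * P s y := by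
    refine (hzflow y).trans ?_
    congr 1
    refine tsum_congr fun s => ?_
    rw [hP, ← ENNReal.tsum_mul_left]
    refine tsum_congr fun b => ?_
    rw [hzρ s b, mul_assoc]
  have hdP (y : S) : d y = ∑' s, d s * P s y := by
    have h1 : Z y + d y = Z y + ∑' s, d s * P s y := by
      rw [← hdX, hXP, hZP, add_assoc, ← ENNReal.tsum_add]
      congr 1
      refine tsum_congr fun s => ?_
      rw [hdX, add_mul]
    exact (ENNReal.add_right_inj (hZfin y)).1 h1
  have hsome (s : S) (b : Option A) : ∑' y, M.withEnd.trans (some s) b (some y) ≤ 1 := by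
    rw [← (M.withEnd.trans (some s) b).tsum_coe, ENNReal.tsum_option]
    exact le_add_self
  set D : Set S := {s | d s ≠ 0} with hDdef
  set Q : S → ℝ≥0∞ := fun s => ∑' b, ρ (some s) b *
    ∑' y, D.indicator (fun y => M.withEnd.trans (some s) b (some y)) y with hQ
  have hind (s : S) (b : Option A) :
      ∑' y, D.indicator (fun y => M.withEnd.trans (some s) b (some y)) y ≤ 1 :=
    (ENNReal.tsum_le_tsum fun y => Set.indicator_le_self _ _ _).trans (hsome s b)
  -- `Q s` is the probability of staying in `D`. Invariance prevents loss of the finite mass of `d`,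
  -- which forces `Q = 1` on `D`.
  have hdQ : ∑' s, d s ≤ ∑' s, d s * Q s := by
    calc ∑' y, d y = ∑' y, ∑' s, d s * D.indicator (P s) y := by
          refine tsum_congr fun y => ?_
          by_cases hy : y ∈ D
          · simp only [Set.indicator_of_mem hy]
            exact hdP y
          · simp only [Set.indicator_of_notMem hy, mul_zero, tsum_zero]
            simpa [hDdef] using hy
      _ = ∑' s, d s * Q s := by
          rw [ENNReal.tsum_comm]
          refine tsum_congr fun s => ?_
          rw [ENNReal.tsum_mul_left]
          congr 1
          rw [hQ]
          simp_rw [← ENNReal.tsum_mul_left]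
          rw [ENNReal.tsum_comm]
          refine tsum_congr fun y => ?_
          by_cases hy : y ∈ D <;> simp [hy, hP]
      _ ≤ _ := le_rfl
  have hQ1 (s : S) : Q s ≤ 1 := by
    rw [← (ρ (some s)).tsum_coe]
    refine ENNReal.tsum_le_tsum fun b => ?_
    exact mul_le_of_le_one_right' (hind s b)
  have hdQle (s : S) : d s * Q s ≤ d s := mul_le_of_le_one_right' (hQ1 s)
  have hdQfin : ∑' s, d s * Q s ≠ ∞ :=
    ne_top_of_le_ne_top hdfin (ENNReal.tsum_le_tsum hdQle)
  have hQD : ∀ s ∈ D, Q s = 1 := by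
    intro s hs
    have h1 := ENNReal.eq_of_le_of_tsum_le hdQle hdQfin hdQ s
    have h2 : d s ≠ ∞ := ENNReal.ne_top_of_tsum_ne_top hdfin s
    exact (ENNReal.mul_right_inj hs h2).1 (by rw [h1, mul_one])
  have hclosed : ∀ s ∈ D, ∀ b, ρ (some s) b ≠ 0 →
      ∑' y, D.indicator (fun y => M.withEnd.trans (some s) b (some y)) y = 1 := by
    intro s hs b hb
    have h1 : ∑' b, ρ (some s) b ≤ ∑' b, ρ (some s) b *
        ∑' y, D.indicator (fun y => M.withEnd.trans (some s) b (some y)) y := by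
      rw [PMF.tsum_coe]; exact (hQD s hs).ge
    have h2 := ENNReal.eq_of_le_of_tsum_le (fun b => mul_le_of_le_one_right' (hind s b))
      (by rw [show ∑' b, _ = _ from hQD s hs]; simp) h1 b
    exact (ENNReal.mul_right_inj hb (PMF.apply_ne_top _ _)).1 (by rw [h2, mul_one])
  have hx' (s : S) (b : Option A) (h : x s b ≠ 0) : ρ (some s) b ≠ 0 := by
    intro h0
    rw [hρ, h0, mul_zero] at h
    exact h rfl
  -- The support `D` is isolated for `x` as well, so `hD` kills `x` on it, although `d ≠ 0` there
  -- requires `x` to be nonzero.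
  obtain ⟨h1, h2⟩ := hx.no_inflow hfin fun s hs b hb => hclosed s hs b (hx' s b hb)
  have h3 := hD D hclosed h1 h2
  have hdz : d s = 0 := by
    by_contra hds
    have : X s = 0 := ENNReal.tsum_eq_zero.2 (h3 s hds)
    simp [hd, this] at hds
  change z s b = x s b
  rw [hzρ, hρ]
  change Z s * _ = X s * _
  rw [hdX, hdz, add_zero]

end MDP

/-! ### Discreteness of the path law, path entropy and Gibbs' inequality. -/

theorem MeasureTheory.lintegral_eq_tsum_of_countable {α : Type*} [MeasurableSpace α]
    [MeasurableSingletonClass α] {μ : Measure α} {C : Set α} (hC : C.Countable)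
    (hμ : ∀ᵐ ξ ∂μ, ξ ∈ C) (g : α → ℝ≥0∞) : ∫⁻ ξ, g ξ ∂μ = ∑' ξ, g ξ * μ {ξ} := by
  have h1 : ∑' ξ : C, g ξ * μ {(ξ : α)} = ∑' ξ, C.indicator (fun ξ => g ξ * μ {ξ}) ξ :=
    tsum_subtype C fun ξ => g ξ * μ {ξ}
  have h2 : ∫⁻ ξ in C, g ξ ∂μ = ∫⁻ ξ, g ξ ∂μ := by
    rw [Measure.restrict_eq_self_of_ae_mem hμ]
  rw [← h2, lintegral_countable g hC, h1]
  refine tsum_congr fun ξ => ?_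
  by_cases h : ξ ∈ C
  · simp [h]
  · have : μ {ξ} = 0 := measure_mono_null (fun x hx => by rw [Set.mem_singleton_iff.1 hx]; exact h)
      (ae_iff.1 hμ)
    simp [h, this]

/-- The pointwise form of Gibbs' inequality. -/
theorem Real.negMulLog_add_le {p q : ℝ} (hp : 0 < p) (hq : 0 < q) :
    Real.negMulLog p + p ≤ p * -Real.log q + q := by
  have h1 := Real.log_le_sub_one_of_pos (div_pos hq hp)
  rw [Real.log_div hq.ne' hp.ne'] at h1
  have h2 := mul_le_mul_of_nonneg_left h1 hp.le
  have h3 : p * (q / p - 1) = q - p := by field_simp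
  rw [Real.negMulLog]
  nlinarith

theorem countable_eventually_eq {α : Type*} [Finite α] (c : α) :
    {ξ : ℕ → α | ∃ n, ∀ t ≥ n, ξ t = c}.Countable := by
  have h : {ξ : ℕ → α | ∃ n, ∀ t ≥ n, ξ t = c} = ⋃ n, {ξ : ℕ → α | ∀ t ≥ n, ξ t = c} := by
    ext ξ; simp
  rw [h]
  refine Set.countable_iUnion fun n => Set.Finite.countable ?_
  refine Set.Finite.of_finite_image (f := fun (ξ : ℕ → α) (k : Fin n) => ξ k) (Set.toFinite _) ?_
  intro ξ hξ ζ hζ h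
  ext t
  by_cases ht : t < n
  · exact congrFun h ⟨t, ht⟩
  · rw [hξ t (not_lt.1 ht), hζ t (not_lt.1 ht)]

namespace MDP

section Prefix

variable {S A : Type*} [Finite S] [Finite A] (M : MDP S A)

theorem measurableSet_prefix (ξ : ℕ → Step S A) (n : ℕ) :
    MeasurableSet {ζ : ℕ → Step S A | ∀ k ≤ n, ζ k = ξ k} := by
  have h : {ζ : ℕ → Step S A | ∀ k ≤ n, ζ k = ξ k} = ⋂ k, ⋂ (_ : k ≤ n), {ζ | ζ k = ξ k} := by
    ext ζ; simp
  rw [h]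
  exact MeasurableSet.iInter fun k => MeasurableSet.iInter fun _ =>
    measurableSet_eval k fun x => x = ξ k

/-- The probability of a finite path under a stationary policy. -/
theorem pathLaw_ofStationary_prefix (ρ : S → PMF A) {ξ : ℕ → Step S A}
    (h0 : (ξ 0).state = M.init) (n : ℕ) :
    M.pathLaw (.ofStationary ρ) {ζ | ∀ k ≤ n, ζ k = ξ k} =
      (∏ t ∈ Finset.range n, ρ (ξ t).state (ξ t).act *
        M.trans (ξ t).state (ξ t).act (ξ (t + 1)).state) * ρ (ξ n).state (ξ n).act := by
  classical
  induction n with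
  | zero =>
    rw [← lintegral_indicator_one (measurableSet_prefix ξ 0)]
    have h := M.lintegral_pathLaw_zero (.ofStationary ρ) fun x => if x = ξ 0 then 1 else 0
    refine Eq.trans (lintegral_congr fun ζ => ?_) (h.trans ?_)
    · simp [Set.indicator_apply]
    · rw [tsum_eq_single (ξ 0).act]
      · simp [Step.ext_iff, h0, Policy.ofStationary]
      · intro b hb
        simp [Step.ext_iff, hb]
  | succ n ih =>
    rw [← lintegral_indicator_one (measurableSet_prefix ξ (n + 1))]
    have h := M.lintegral_pathLaw_succ (.ofStationary ρ) n fun h x =>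
      if (∀ k, h k = ξ k) ∧ x = ξ (n + 1) then 1 else 0
    refine Eq.trans (lintegral_congr fun ζ => ?_) (h.trans ?_)
    · simp only [Set.indicator_apply, Set.mem_ofPred_eq, Preorder.frestrictLe_apply, Pi.one_apply]
      congr 1
      simp only [eq_iff_iff, Subtype.forall, Finset.mem_Iic]
      constructor
      · exact fun h => ⟨fun k hk => h k (by omega), h _ le_rfl⟩
      · rintro ⟨h1, h2⟩ k hk
        rcases Nat.lt_or_ge n k with h | h
        · obtain rfl : k = n + 1 := by omega
          exact h2
        · exact h1 k h
    · rw [Finset.prod_range_succ, ← mul_assoc, ← ih,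
        ← lintegral_indicator_one (measurableSet_prefix ξ n),
        mul_assoc, ← lintegral_mul_const' _ _
          (ENNReal.mul_ne_top (PMF.apply_ne_top _ _) (PMF.apply_ne_top _ _))]
      refine lintegral_congr fun ζ => ?_
      by_cases hζ : ∀ k ≤ n, ζ k = ξ k
      · rw [Set.indicator_of_mem (by exact hζ), tsum_eq_single (ξ (n + 1)).state,
          tsum_eq_single (ξ (n + 1)).act]
        · simp only [hζ n le_rfl, Policy.ofStationary, Pi.one_apply, one_mul]
          rw [if_pos ⟨fun k => hζ k (Finset.mem_Iic.1 k.2), trivial⟩, mul_one]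
        · intro b hb
          simp [Step.ext_iff, hb]
        · intro y hy
          simp [Step.ext_iff, hy]
      · rw [Set.indicator_of_notMem (by exact hζ), zero_mul]
        have : ¬ ∀ k : Finset.Iic n, Preorder.frestrictLe n ζ k = ξ k := fun h =>
          hζ fun k hk => h ⟨k, Finset.mem_Iic.2 hk⟩
        simp only [this, false_and, if_false, mul_zero, tsum_zero]

end Prefix

variable {S A : Type*} [Finite S] [Finite A] (M : MDP S A)

/-- The step that is repeated forever after the end of the game. -/
def endStep (S A : Type*) : Step (Option S) (Option A) := ⟨none, none⟩

variable {M} {π : Policy (Option S) (Option A)}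

theorem ae_eq_endStep (hπ : ∀ n h, π n h none = PMF.pure none) :
    ∀ᵐ ξ ∂(M.withEnd.pathLaw π), ∀ t, (ξ t).state = none → ∀ k ≥ t, ξ k = endStep S A := by
  filter_upwards [M.withEnd.ae_occupancy_ne_zero π, M.withEnd.ae_trans_ne_zero π] with ξ h1 h2 t ht
  have hact (k : ℕ) (hk : (ξ k).state = none) : ξ k = endStep S A := by
    refine Step.ext hk ?_
    by_contra hne
    refine h1 k (M.withEnd.occupancy_eq_zero π fun n h => ?_)
    rw [hk, hπ]
    exact PMF.pure_apply_of_ne _ _ hne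
  intro k hk
  refine hact k ?_
  induction k, hk using Nat.le_induction with
  | base => exact ht
  | succ k hk ih =>
    have := h2 k
    rw [ih, withEnd_trans_none] at this
    by_contra hne
    exact this (PMF.pure_apply_of_ne _ _ hne)

/-- The time spent before the end state has finite expectation, so it is almost surely finite. -/
theorem ae_exists_state_eq_none
    (hfin : ∑' (s : S) (b : Option A), M.withEnd.occupancy π (some s) b ≠ ∞) :
    ∀ᵐ ξ ∂(M.withEnd.pathLaw π), ∃ t, (ξ t).state = none := by
  classical
  set f : Step (Option S) (Option A) → ℝ≥0∞ := fun x => if x.state = none then 0 else 1 with hf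
  have h := M.withEnd.lintegral_tsum_eval π f
  rw [ENNReal.tsum_option] at h
  simp only [hf, if_true, mul_zero, tsum_zero, zero_add, reduceCtorEq, if_false, mul_one] at h
  have hm : Measurable fun ξ : ℕ → Step (Option S) (Option A) => ∑' t, f (ξ t) :=
    Measurable.tsum fun t => (measurable_of_countable f).comp (measurable_pi_apply t)
  have := ae_lt_top hm (h ▸ hfin)
  filter_upwards [this] with ξ hξ
  by_contra! hne
  simp [hf, hne] at hξ

theorem ae_mem_eventually_endStep (hπ : ∀ n h, π n h none = PMF.pure none)
    (hfin : ∑' (s : S) (b : Option A), M.withEnd.occupancy π (some s) b ≠ ∞) :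
    ∀ᵐ ξ ∂(M.withEnd.pathLaw π), ξ ∈ {ξ | ∃ n, ∀ t ≥ n, ξ t = endStep S A} := by
  filter_upwards [ae_eq_endStep (M := M) hπ, ae_exists_state_eq_none (M := M) hfin]
    with ξ h1 ⟨t, ht⟩
  exact ⟨t, h1 t ht⟩

variable (M) in
/-- The information content of an action and the following transition under a stationary policy. -/
def stepCost (ρ : Option S → PMF (Option A)) (x : Step (Option S) (Option A)) (y : Option S) :
    ℝ≥0∞ :=
  ENNReal.ofReal (-Real.log (ρ x.state x.act).toReal) +
    ENNReal.ofReal (-Real.log (M.withEnd.trans x.state x.act y).toReal)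

theorem neg_log_toReal_nonneg {α : Type*} (p : PMF α) (a : α) : 0 ≤ -Real.log (p a).toReal := by
  rw [neg_nonneg]
  exact Real.log_nonpos ENNReal.toReal_nonneg
    (ENNReal.toReal_le_of_le_ofReal zero_le_one (by simpa using p.coe_le_one a))

/-- After the end state is reached the continuation is almost surely determined, so a single path
has the probability of its prefix. -/
theorem pathLaw_ofStationary_singleton {ρ : Option S → PMF (Option A)}
    (hρ : ρ none = PMF.pure none) {ξ : ℕ → Step (Option S) (Option A)}
    (h0 : (ξ 0).state = some M.init) {n : ℕ} (hn : ∀ t ≥ n, ξ t = endStep S A) :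
    M.withEnd.pathLaw (.ofStationary ρ) {ξ} =
      ∏ t ∈ Finset.range n, ρ (ξ t).state (ξ t).act *
        M.withEnd.trans (ξ t).state (ξ t).act (ξ (t + 1)).state := by
  have h1 : M.withEnd.pathLaw (.ofStationary ρ) {ξ} =
      M.withEnd.pathLaw (.ofStationary ρ) {ζ | ∀ k ≤ n, ζ k = ξ k} := by
    refine measure_congr ?_
    filter_upwards [ae_eq_endStep (M := M) (π := .ofStationary ρ) fun _ _ => hρ] with ζ hζ
    refine propext ⟨?_, fun h => ?_⟩
    · rintro rfl k _
      rfl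
    · refine funext fun t => ?_
      rcases le_total t n with ht | ht
      · exact h t ht
      · rw [hn t ht]
        refine hζ n ?_ t ht
        rw [h n le_rfl, hn n le_rfl]
        rfl
  rw [h1, M.withEnd.pathLaw_ofStationary_prefix ρ h0, hn n le_rfl]
  simp [endStep, hρ]

/-- The information content of a path is the sum of the information contents of its steps. -/
theorem neg_log_pathLaw_ofStationary {ρ : Option S → PMF (Option A)}
    (hρ : ρ none = PMF.pure none) {ξ : ℕ → Step (Option S) (Option A)}
    (h0 : (ξ 0).state = some M.init) {n : ℕ} (hn : ∀ t ≥ n, ξ t = endStep S A)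
    (hact : ∀ t, ρ (ξ t).state (ξ t).act ≠ 0)
    (htrans : ∀ t, M.withEnd.trans (ξ t).state (ξ t).act (ξ (t + 1)).state ≠ 0) :
    0 < (M.withEnd.pathLaw (.ofStationary ρ)).real {ξ} ∧
    ENNReal.ofReal (-Real.log ((M.withEnd.pathLaw (.ofStationary ρ)).real {ξ})) =
      ∑' t, M.stepCost ρ (ξ t) (ξ (t + 1)).state := by
  have hpos (t : ℕ) : (0 : ℝ) < (ρ (ξ t).state (ξ t).act).toReal :=
    ENNReal.toReal_pos (hact t) (PMF.apply_ne_top _ _)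
  have hpos' (t : ℕ) :
      (0 : ℝ) < (M.withEnd.trans (ξ t).state (ξ t).act (ξ (t + 1)).state).toReal :=
    ENNReal.toReal_pos (htrans t) (PMF.apply_ne_top _ _)
  rw [measureReal_def, pathLaw_ofStationary_singleton hρ h0 hn, ENNReal.toReal_prod]
  simp_rw [ENNReal.toReal_mul]
  refine ⟨Finset.prod_pos fun t _ => mul_pos (hpos t) (hpos' t), ?_⟩
  rw [Real.log_prod (fun t _ => (mul_pos (hpos t) (hpos' t)).ne'), ← Finset.sum_neg_distrib,
    ENNReal.ofReal_sum_of_nonneg, tsum_eq_sum (s := Finset.range n)]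
  · refine Finset.sum_congr rfl fun t _ => ?_
    rw [Real.log_mul (hpos t).ne' (hpos' t).ne', neg_add,
      ENNReal.ofReal_add (neg_log_toReal_nonneg _ _) (neg_log_toReal_nonneg _ _)]
    rfl
  · intro t ht
    have ht' : n ≤ t := by simpa using ht
    rw [hn t ht', hn (t + 1) (by omega)]
    simp [stepCost, endStep, hρ]
  · intro t _
    rw [Real.log_mul (hpos t).ne' (hpos' t).ne', neg_add]
    exact add_nonneg (neg_log_toReal_nonneg _ _) (neg_log_toReal_nonneg _ _)

variable (M π) in
/-- The expected information content, under the stationary policy `ρ`, of the path generated by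
`π`. -/
def crossEntropy (ρ : Option S → PMF (Option A)) : ℝ≥0∞ :=
  ∑' (s : S) (b : Option A), M.withEnd.occupancy π (some s) b *
    (ENNReal.ofReal (-Real.log (ρ (some s) b).toReal) +
      ∑' y, ENNReal.ofReal (Real.negMulLog (M.withEnd.trans (some s) b y).toReal))

theorem lintegral_tsum_stepCost (hπ : ∀ n h, π n h none = PMF.pure none)
    {ρ : Option S → PMF (Option A)} (hρ : ρ none = PMF.pure none) :
    ∫⁻ ξ, ∑' t, M.stepCost ρ (ξ t) (ξ (t + 1)).state ∂(M.withEnd.pathLaw π) =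
      M.crossEntropy π ρ := by
  have hT (p : PMF (Option S)) (y : Option S) : p y * ENNReal.ofReal (-Real.log (p y).toReal) =
      ENNReal.ofReal (Real.negMulLog (p y).toReal) := by
    rw [Real.negMulLog, neg_mul_comm, ENNReal.ofReal_mul ENNReal.toReal_nonneg,
      ENNReal.ofReal_toReal (p.apply_ne_top y)]
  rw [lintegral_tsum_eval_succ, ENNReal.tsum_option, ENNReal.tsum_eq_zero.2, zero_add]
  · refine tsum_congr fun s => tsum_congr fun b => ?_
    congr 1
    simp only [stepCost, mul_add]
    rw [ENNReal.tsum_add, ENNReal.tsum_mul_right, PMF.tsum_coe, one_mul]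
    simp_rw [hT]
  · intro b
    cases b with
    | none =>
      -- The occupancy of the end step may be infinite; its cost is zero, and `∞ * 0 = 0`.
      rw [ENNReal.tsum_eq_zero.2, mul_zero]
      intro y
      cases y with
      | none => simp [stepCost, hρ]
      | some y => simp
    | some a =>
      rw [M.withEnd.occupancy_eq_zero π fun n h => by simp [hπ], zero_mul]

/-- The entropy of a path is the cross entropy with respect to the generating stationary policy. -/
theorem pathEntropy_ofStationary {ρ : Option S → PMF (Option A)} (hρ : ρ none = PMF.pure none)
    (hfin : ∑' (s : S) (b : Option A),
      M.withEnd.occupancy (.ofStationary ρ) (some s) b ≠ ∞) :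
    M.withEnd.pathEntropy (.ofStationary ρ) = M.crossEntropy (.ofStationary ρ) ρ := by
  have hπ : ∀ n h, Policy.ofStationary ρ n h none = PMF.pure none := fun _ _ => hρ
  rw [← lintegral_tsum_stepCost hπ hρ, lintegral_eq_tsum_of_countable
    (countable_eventually_eq (endStep S A)) (ae_mem_eventually_endStep hπ hfin), pathEntropy]
  refine tsum_congr fun ξ => ?_
  by_cases hξ : M.withEnd.pathLaw (.ofStationary ρ) {ξ} = 0
  · simp [measureReal_def, hξ]
  have hmem {p : (ℕ → Step (Option S) (Option A)) → Prop}
      (h : ∀ᵐ ζ ∂(M.withEnd.pathLaw (.ofStationary ρ)), p ζ) : p ξ := by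
    by_contra hp
    exact hξ (measure_mono_null (by simpa using hp) (ae_iff.1 h))
  obtain ⟨n, hn⟩ := hmem (ae_mem_eventually_endStep hπ hfin)
  have hact (t : ℕ) : ρ (ξ t).state (ξ t).act ≠ 0 := fun h =>
    hmem (M.withEnd.ae_occupancy_ne_zero _) t (M.withEnd.occupancy_eq_zero _ fun _ _ => h)
  rw [← (neg_log_pathLaw_ofStationary hρ (hmem (M.withEnd.ae_init _)) hn hact
    (hmem (M.withEnd.ae_trans_ne_zero _))).2, Real.negMulLog, neg_mul_comm,
    ENNReal.ofReal_mul measureReal_nonneg, mul_comm, ofReal_measureReal]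

/-- Gibbs' inequality for paths: the entropy is at most the cross entropy with respect to a
stationary policy. -/
theorem pathEntropy_le_crossEntropy (hπ : ∀ n h, π n h none = PMF.pure none)
    (hfin : ∑' (s : S) (b : Option A), M.withEnd.occupancy π (some s) b ≠ ∞)
    {ρ : Option S → PMF (Option A)} (hρ : ρ none = PMF.pure none)
    (hac : ∀ s b, M.withEnd.occupancy π (some s) b ≠ 0 → ρ (some s) b ≠ 0) :
    M.withEnd.pathEntropy π ≤ M.crossEntropy π ρ := by
  have hC := ae_mem_eventually_endStep hπ hfin
  have hcount := countable_eventually_eq (endStep S A)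
  set P := M.withEnd.pathLaw π with hP
  set Q := M.withEnd.pathLaw (.ofStationary ρ) with hQ
  have hP1 : ∑' ξ, P {ξ} = 1 := by
    have := lintegral_eq_tsum_of_countable hcount hC fun _ => 1
    simpa using this.symm
  -- An inequality suffices, so nothing needs to be known about termination under `ρ`.
  have hQ1 : ∑' ξ, Q {ξ} ≤ 1 := by
    refine (tsum_meas_le_meas_iUnion_of_disjoint Q (fun ξ => measurableSet_singleton ξ)
      fun ξ ζ h => by simpa using h).trans prob_le_one
  -- Both correction terms are added rather than subtracted, so that the inequality can be summed in
  -- `ℝ≥0∞`.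
  have hle (ξ : ℕ → Step (Option S) (Option A)) :
      ENNReal.ofReal (Real.negMulLog (P.real {ξ})) + P {ξ} ≤
        (∑' t, M.stepCost ρ (ξ t) (ξ (t + 1)).state) * P {ξ} + Q {ξ} := by
    by_cases hξ : P {ξ} = 0
    · simp [measureReal_def, hξ]
    have hmem {p : (ℕ → Step (Option S) (Option A)) → Prop} (h : ∀ᵐ ζ ∂P, p ζ) : p ξ := by
      by_contra hp
      exact hξ (measure_mono_null (by simpa using hp) (ae_iff.1 h))
    obtain ⟨n, hn⟩ := hmem hC
    have hend := hmem (ae_eq_endStep (M := M) hπ)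
    -- As `Real.log 0 = 0`, `stepCost` would charge nothing for an impossible action; `hac` excludes
    -- these on paths charged by `P`.
    have hact (t : ℕ) : ρ (ξ t).state (ξ t).act ≠ 0 := by
      have h1 := hmem (M.withEnd.ae_occupancy_ne_zero _) t
      cases hs : (ξ t).state with
      | none =>
        have := congrArg Step.act (hend t hs t le_rfl)
        simp [hρ, this, endStep]
      | some s => exact hac s _ (hs ▸ h1)
    obtain ⟨h1, h2⟩ := neg_log_pathLaw_ofStationary hρ (hmem (M.withEnd.ae_init _)) hn hact
      (hmem (M.withEnd.ae_trans_ne_zero _))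
    have hp : 0 < P.real {ξ} := ENNReal.toReal_pos hξ (measure_ne_top _ _)
    rw [← h2, mul_comm]
    have hPr : P {ξ} = ENNReal.ofReal (P.real {ξ}) := (ofReal_measureReal (measure_ne_top _ _)).symm
    have hQr : Q {ξ} = ENNReal.ofReal (Q.real {ξ}) := (ofReal_measureReal (measure_ne_top _ _)).symm
    rw [hPr, hQr, ← ENNReal.ofReal_mul hp.le]
    refine (ENNReal.ofReal_add ?_ hp.le).ge.trans
      ((ENNReal.ofReal_le_ofReal (Real.negMulLog_add_le hp h1)).trans ENNReal.ofReal_add_le)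
    exact Real.negMulLog_nonneg hp.le measureReal_le_one
  have hsum := ENNReal.tsum_le_tsum hle
  rw [ENNReal.tsum_add, ENNReal.tsum_add, hP1, ← lintegral_eq_tsum_of_countable hcount hC,
    lintegral_tsum_stepCost hπ hρ] at hsum
  exact (ENNReal.add_le_add_iff_right ENNReal.one_ne_top).1 (hsum.trans (by gcongr))

end MDP

/-! ### Path entropy as a continuous function of the occupancy measure. -/

namespace MDP

variable {S A : Type*}

open Classical in
/-- The stationary policy whose action probabilities at `s` are proportional to `x s`. It takes the
action `none` at the end state and follows `d` where the proportions are undefined. -/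
def proportionalPolicy (x : S → Option A → ℝ≥0∞) (d : S → PMF (Option A)) :
    Option S → PMF (Option A)
  | none => PMF.pure none
  | some s => if h : ∑' b, x s b ≠ 0 ∧ ∑' b, x s b ≠ ∞ then PMF.normalize (x s) h.1 h.2 else d s

theorem proportionalPolicy_spec (x : S → Option A → ℝ≥0∞) (d : S → PMF (Option A)) (s : S)
    (hx : ∑' b, x s b ≠ ∞) (b : Option A) :
    x s b = (∑' c, x s c) * proportionalPolicy x d (some s) b := by
  by_cases h : ∑' b, x s b = 0
  · rw [h, zero_mul]
    exact ENNReal.tsum_eq_zero.1 h b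
  · rw [proportionalPolicy, dif_pos ⟨h, hx⟩, PMF.normalize_apply, mul_comm, mul_assoc,
      ENNReal.inv_mul_cancel h hx, mul_one]

variable [Fintype S] [Fintype A] (M : MDP S A)

/-- The entropy of the path that a stationary policy with the occupancy measure `x` generates. -/
def entropyFlow (x : S → Option A → ℝ) : ℝ :=
  ∑ s, (∑ b, Real.negMulLog (x s b) - Real.negMulLog (∑ b, x s b) +
    ∑ b, x s b * ∑ y, Real.negMulLog (M.withEnd.trans (some s) b y).toReal)

theorem continuous_entropyFlow : Continuous M.entropyFlow := by
  unfold entropyFlow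
  fun_prop

variable {M} {π : Policy (Option S) (Option A)}

theorem crossEntropy_eq_ofReal
    (hfin : ∑' (s : S) (b : Option A), M.withEnd.occupancy π (some s) b ≠ ∞)
    {ρ : Option S → PMF (Option A)}
    (hρ : ∀ s b, M.withEnd.occupancy π (some s) b =
      (∑' c, M.withEnd.occupancy π (some s) c) * ρ (some s) b) :
    M.crossEntropy π ρ =
      ENNReal.ofReal (M.entropyFlow fun s b => (M.withEnd.occupancy π (some s) b).toReal) := by
  set x : S → Option A → ℝ := fun s b => (M.withEnd.occupancy π (some s) b).toReal with hx
  have hocc (s : S) (b : Option A) : M.withEnd.occupancy π (some s) b ≠ ∞ :=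
    ENNReal.ne_top_of_tsum_ne_top (ENNReal.ne_top_of_tsum_ne_top hfin s) b
  have hx0 (s : S) (b : Option A) : 0 ≤ x s b := ENNReal.toReal_nonneg
  have hxρ (s : S) (b : Option A) : x s b = (∑ c, x s c) * (ρ (some s) b).toReal := by
    simp only [hx]
    rw [hρ, ENNReal.toReal_mul, tsum_fintype, ENNReal.toReal_sum fun c _ => hocc s c]
  have hT (s : S) (b : Option A) (y : Option S) :
      0 ≤ Real.negMulLog (M.withEnd.trans (some s) b y).toReal :=
    Real.negMulLog_nonneg ENNReal.toReal_nonneg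
      (ENNReal.toReal_le_of_le_ofReal zero_le_one (by simpa using PMF.coe_le_one _ y))
  have hterm (s : S) (b : Option A) : M.withEnd.occupancy π (some s) b *
      (ENNReal.ofReal (-Real.log (ρ (some s) b).toReal) +
        ∑' y, ENNReal.ofReal (Real.negMulLog (M.withEnd.trans (some s) b y).toReal)) =
      ENNReal.ofReal (x s b * (-Real.log (ρ (some s) b).toReal +
        ∑ y, Real.negMulLog (M.withEnd.trans (some s) b y).toReal)) := by
    rw [tsum_fintype, ← ENNReal.ofReal_sum_of_nonneg fun y _ => hT s b y,
      ← ENNReal.ofReal_add (neg_log_toReal_nonneg _ _) (Finset.sum_nonneg fun y _ => hT s b y),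
      ENNReal.ofReal_mul (hx0 s b), ENNReal.ofReal_toReal (hocc s b)]
  have hterm0 (s : S) (b : Option A) : 0 ≤ x s b * (-Real.log (ρ (some s) b).toReal +
        ∑ y, Real.negMulLog (M.withEnd.trans (some s) b y).toReal) :=
    mul_nonneg (hx0 s b) (add_nonneg (neg_log_toReal_nonneg _ _)
      (Finset.sum_nonneg fun y _ => hT s b y))
  rw [crossEntropy]
  simp_rw [hterm]
  rw [tsum_fintype]
  simp_rw [tsum_fintype (L := .unconditional (Option A))]
  rw [Finset.sum_congr rfl fun s _ => (ENNReal.ofReal_sum_of_nonneg fun b _ => hterm0 s b).symm,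
    ← ENNReal.ofReal_sum_of_nonneg fun s _ => Finset.sum_nonneg fun b _ => hterm0 s b]
  congr 1
  refine Finset.sum_congr rfl fun s _ => ?_
  simp_rw [mul_add]
  rw [Finset.sum_add_distrib]
  congr 1
  have hρ1 : ∑ b, (ρ (some s) b).toReal = 1 := by
    rw [← ENNReal.toReal_sum fun b _ => PMF.apply_ne_top _ _,
      ← tsum_fintype (L := .unconditional _),
      PMF.tsum_coe, ENNReal.toReal_one]
  -- The chain rule for entropy at `s`: the row `x s` is its total mass times the action
  -- distribution.
  have h1 (b : Option A) : Real.negMulLog (x s b) =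
      (ρ (some s) b).toReal * Real.negMulLog (∑ c, x s c) +
        x s b * -Real.log (ρ (some s) b).toReal := by
    conv_lhs => rw [hxρ, Real.negMulLog_mul]
    rw [Real.negMulLog, Real.negMulLog, hxρ s b]
    ring
  simp_rw [h1]
  rw [Finset.sum_add_distrib, ← Finset.sum_mul, hρ1]
  ring

theorem pathEntropy_ofStationary_eq {ρ : Option S → PMF (Option A)} (hρ : ρ none = PMF.pure none)
    (hfin : ∑' (s : S) (b : Option A), M.withEnd.occupancy (.ofStationary ρ) (some s) b ≠ ∞) :
    M.withEnd.pathEntropy (.ofStationary ρ) = ENNReal.ofReal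
      (M.entropyFlow fun s b => (M.withEnd.occupancy (.ofStationary ρ) (some s) b).toReal) := by
  rw [pathEntropy_ofStationary hρ hfin, crossEntropy_eq_ofReal hfin fun s b =>
    M.withEnd.occupancy_ofStationary ρ (some s) b]

/-- Gibbs' inequality against the proportional policy. The cross entropy is an expectation under
`π`, so no comparison of the occupancies of the two policies is needed. -/
theorem pathEntropy_le (hπ : ∀ n h, π n h none = PMF.pure none)
    (hfin : ∑' (s : S) (b : Option A), M.withEnd.occupancy π (some s) b ≠ ∞) :
    M.withEnd.pathEntropy π ≤ ENNReal.ofReal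
      (M.entropyFlow fun s b => (M.withEnd.occupancy π (some s) b).toReal) := by
  have hspec := fun s b => proportionalPolicy_spec (fun s b => M.withEnd.occupancy π (some s) b)
    (fun _ => PMF.pure none) s (ENNReal.ne_top_of_tsum_ne_top hfin s) b
  rw [← crossEntropy_eq_ofReal hfin hspec]
  refine pathEntropy_le_crossEntropy hπ hfin rfl fun s b h h0 => h ?_
  rw [hspec s b, h0, mul_zero]

/-- Each `x b` is at most the total, and `-log` is decreasing. This gives `entropyFlow_nonneg`, so
that `ENNReal.ofReal` loses nothing. -/
theorem negMulLog_sum_le {α : Type*} (t : Finset α) {x : α → ℝ} (hx : ∀ b, 0 ≤ x b) :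
    Real.negMulLog (∑ b ∈ t, x b) ≤ ∑ b ∈ t, Real.negMulLog (x b) := by
  have h1 : Real.negMulLog (∑ b ∈ t, x b) = ∑ b ∈ t, x b * -Real.log (∑ c ∈ t, x c) := by
    rw [← Finset.sum_mul, Real.negMulLog, neg_mul_comm]
  rw [h1]
  refine Finset.sum_le_sum fun b hb => ?_
  rcases (hx b).eq_or_lt with h | h
  · simp [← h]
  · rw [Real.negMulLog, neg_mul_comm]
    have := Real.log_le_log h (Finset.single_le_sum (fun c _ => hx c) hb)
    gcongr

theorem entropyFlow_nonneg {x : S → Option A → ℝ} (hx : ∀ s b, 0 ≤ x s b) :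
    0 ≤ M.entropyFlow x := by
  refine Finset.sum_nonneg fun s _ => add_nonneg ?_ ?_
  · exact sub_nonneg.2 (negMulLog_sum_le _ (hx s))
  · exact Finset.sum_nonneg fun b _ => mul_nonneg (hx s b) (Finset.sum_nonneg fun y _ =>
      Real.negMulLog_nonneg ENNReal.toReal_nonneg
        (ENNReal.toReal_le_of_le_ofReal zero_le_one (by simpa using PMF.coe_le_one _ y)))

end MDP

/-! ### Agent marginals and the processes `X̄^i`. -/

theorem PMF.eq_pure_of_support_subset {α : Type*} {p : PMF α} {a : α} (h : p.support ⊆ {a}) :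
    p = PMF.pure a := by
  classical
  have h0 : ∀ b, b ≠ a → p b = 0 := fun b hb => by
    rw [PMF.apply_eq_zero_iff]
    exact fun hb' => hb (h hb')
  have h1 : p a = 1 := by rw [← p.tsum_coe, tsum_eq_single a h0]
  ext b
  by_cases hb : b = a
  · rw [hb, h1, PMF.pure_apply_self]
  · rw [h0 b hb, PMF.pure_apply_of_ne _ _ hb]

theorem productPMF_marginal {N : ℕ} {S : Fin N → Type*} [∀ i, Fintype (S i)]
    (p : ∀ i, PMF (S i)) (i : Fin N) (y : S i) [DecidableEq (S i)] :
    ∑' s : ∀ i, S i, (if s i = y then productPMF p s else 0) = p i y := by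
  classical
  rw [tsum_fintype, ← Finset.sum_filter]
  have h : (Finset.univ.filter fun s : ∀ i, S i => s i = y) =
      Fintype.piFinset (Function.update (fun j => (Finset.univ : Finset (S j))) i {y}) := by
    rw [Fintype.piFinset_update_singleton_eq_filter_piFinset_eq (fun j => Finset.univ) i
      (Finset.mem_univ _), Fintype.piFinset_univ]
    ext s
    simp
  rw [h]
  change ∑ s ∈ Fintype.piFinset _, ∏ j, p j (s j) = _
  rw [← Finset.prod_univ_sum, Finset.prod_eq_single i]
  · simp
  · intro j _ hj
    rw [Function.update_of_ne hj, ← tsum_fintype (L := .unconditional _), PMF.tsum_coe]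
  · simp

namespace TeamGame

variable {N : ℕ} {S A : Fin N → Type*} [∀ i, Fintype (S i)] [∀ i, Fintype (A i)]
  (G : TeamGame S A) {π : Policy (Option (∀ i, S i)) (Option (∀ i, A i))}

theorem policies_none (hπ : π ∈ G.policies) (n : ℕ)
    (h : Fin n → Step (Option (∀ i, S i)) (Option (∀ i, A i))) : π n h none = PMF.pure none :=
  PMF.eq_pure_of_support_subset (hπ n h none)

theorem trans_marginal (i : Fin N) (s : ∀ i, S i) (a : Option (∀ i, A i)) (y : S i)
    [DecidableEq (S i)] :
    ∑' z : ∀ i, S i, (if z i = y then G.joint.withEnd.trans (some s) a (some z) else 0) =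
      (G.agent i).withEnd.trans (some (s i)) (a.map fun a => a i) (some y) := by
  cases a with
  | none => simp
  | some a =>
    rw [Option.map_some, MDP.withEnd_trans_some_some, ← productPMF_marginal
      (fun i => (G.agent i).trans (s i) (a i)) i y]
    simp_rw [MDP.withEnd_trans_some_some]
    rfl

theorem trans_le_trans_agent (i : Fin N) (s y : ∀ i, S i) (a : Option (∀ i, A i)) :
    G.joint.withEnd.trans (some s) a (some y) ≤
      (G.agent i).withEnd.trans (some (s i)) (a.map fun a => a i) (some (y i)) := by
  classical
  rw [← trans_marginal]
  refine le_trans ?_ (ENNReal.le_tsum y)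
  simp

open Classical in
theorem agentOccupancy_some (i : Fin N) (si : S i) (ai : Option (A i)) :
    G.agentOccupancy π i (some si) ai = ∑ s : ∀ i, S i, ∑ a : Option (∀ i, A i),
      if s i = si ∧ a.map (fun a => a i) = ai then
        G.joint.withEnd.occupancy π (some s) a else 0 := by
  rw [agentOccupancy, Fintype.sum_option]
  simp [preprocessed]

theorem agentOccupancy_sum (i : Fin N) (f : S i → Option (A i) → ℝ≥0∞) :
    ∑' (si : S i) (ai : Option (A i)), G.agentOccupancy π i (some si) ai * f si ai =
      ∑' (s : ∀ i, S i) (a : Option (∀ i, A i)),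
        G.joint.withEnd.occupancy π (some s) a * f (s i) (a.map fun a => a i) := by
  classical
  simp_rw [agentOccupancy_some, Finset.sum_mul, tsum_fintype]
  have h1 (si : S i) : ∑ ai : Option (A i), ∑ s : ∀ i, S i, ∑ a : Option (∀ i, A i),
      (if s i = si ∧ a.map (fun a => a i) = ai then
        G.joint.withEnd.occupancy π (some s) a else 0) * f si ai =
      ∑ s : ∀ i, S i, ∑ a : Option (∀ i, A i), ∑ ai : Option (A i),
      (if s i = si ∧ a.map (fun a => a i) = ai then
        G.joint.withEnd.occupancy π (some s) a else 0) * f si ai := by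
    rw [Finset.sum_comm]
    exact Finset.sum_congr rfl fun s _ => Finset.sum_comm
  rw [Finset.sum_congr rfl fun si _ => h1 si, Finset.sum_comm]
  refine Finset.sum_congr rfl fun s _ => ?_
  rw [Finset.sum_comm]
  refine Finset.sum_congr rfl fun a _ => ?_
  rw [Finset.sum_eq_single (s i), Finset.sum_eq_single (a.map fun a => a i)]
  · simp
  · intro ai _ h
    simp [h.symm]
  · simp
  · intro si _ h
    simp [h.symm]
  · simp

/-- Sum the joint flow equations over the states with `i`-th component `y`. The marginal of the
product transition depends only on the `i`-th components of state and action, by `trans_marginal`.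
-/
theorem isFlow_agentOccupancy (i : Fin N) :
    (G.agent i).IsFlow fun si ai => G.agentOccupancy π i (some si) ai := by
  classical
  intro y
  rw [agentOccupancy_sum]
  have h1 := G.agentOccupancy_sum (π := π) i fun si _ => if si = y then 1 else 0
  rw [tsum_eq_single y (by intro si hsi; simp [hsi])] at h1
  simp only [if_true, mul_one] at h1
  rw [h1]
  have h2 (s : ∀ i, S i) : ∑' a : Option (∀ i, A i), G.joint.withEnd.occupancy π (some s) a *
      (if s i = y then 1 else 0) = ({G.joint.init} : Set (∀ i, S i)).indicator 1 s *
        (if s i = y then 1 else 0) + ∑' (t : ∀ i, S i) (a : Option (∀ i, A i)),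
          G.joint.withEnd.occupancy π (some t) a *
            (if s i = y then G.joint.withEnd.trans (some t) a (some s) else 0) := by
    rw [ENNReal.tsum_mul_right, G.joint.isFlow_occupancy π s]
    by_cases hs : s i = y <;> simp [hs]
  rw [tsum_congr h2, ENNReal.tsum_add]
  congr 1
  · rw [tsum_eq_single G.joint.init (by intro s hs; simp [hs])]
    simp [joint, Set.indicator_apply, eq_comm]
  · rw [ENNReal.tsum_comm]
    refine tsum_congr fun t => ?_
    rw [ENNReal.tsum_comm]
    refine tsum_congr fun a => ?_
    rw [ENNReal.tsum_mul_left, trans_marginal]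

theorem tsum_agentOccupancy (i : Fin N) :
    ∑' (si : S i) (ai : Option (A i)), G.agentOccupancy π i (some si) ai =
      ∑' (s : ∀ i, S i) (a : Option (∀ i, A i)), G.joint.withEnd.occupancy π (some s) a := by
  simpa using G.agentOccupancy_sum (π := π) i fun _ _ => 1

theorem agentPolicy_none (hπ : π ∈ G.policies) (i : Fin N) :
    G.agentPolicy π i none = PMF.pure none := by
  classical
  rw [agentPolicy]
  -- The row of the end state may have infinite mass; then the default of `agentPolicy` applies.
  split_ifs with h
  · refine PMF.eq_pure_of_support_subset fun b hb => ?_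
    rw [PMF.support_normalize] at hb
    by_contra hne
    refine hb (Finset.sum_eq_zero fun s _ => Finset.sum_eq_zero fun a _ => ?_)
    split_ifs with hsa
    · cases s with
      | some s => simp at hsa
      | none =>
        cases a with
        | none => exact absurd hsa.2.symm hne
        | some a =>
          exact MDP.occupancy_eq_zero _ _ fun n k => by simp [G.policies_none hπ]
    · rfl
  · rfl

theorem agentPolicy_some (i : Fin N) (si : S i) :
    G.agentPolicy π i (some si) = MDP.proportionalPolicy
      (fun si ai => G.agentOccupancy π i (some si) ai) (fun _ => PMF.pure none) (some si) := rfl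

theorem stationaryOccupancy_eq
    (hfin : ∑' (s : ∀ i, S i) (a : Option (∀ i, A i)), G.joint.withEnd.occupancy π (some s) a ≠ ∞)
    (i : Fin N) (si : S i) (ai : Option (A i)) :
    G.stationaryOccupancy π i (some si) ai = G.agentOccupancy π i (some si) ai := by
  classical
  have hfin' : ∑' (si : S i) (ai : Option (A i)), G.agentOccupancy π i (some si) ai ≠ ∞ := by
    rwa [tsum_agentOccupancy]
  refine (G.isFlow_agentOccupancy i).occupancy_eq hfin' (fun si ai => ?_) ?_ si ai
  · rw [agentPolicy_some]
    exact MDP.proportionalPolicy_spec (fun si ai => G.agentOccupancy π i (some si) ai) _ si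
      (ENNReal.ne_top_of_tsum_ne_top hfin' si) ai
  -- If agent `i` has no inflow into `D`, the joint process has none into the states whose `i`-th
  -- component lies in `D`, so they are never visited and the marginal vanishes on `D`.
  · intro D _ h0 hD si hsi ai
    have h1 := G.joint.occupancy_eq_zero_of_no_inflow π (D := {s | s i ∈ D}) h0 ?_
    · rw [agentOccupancy_some]
      refine Finset.sum_eq_zero fun s _ => Finset.sum_eq_zero fun a _ => ?_
      split_ifs with h
      · exact h1 s (by rw [Set.mem_ofPred_eq, h.1]; exact hsi) a
      · rfl
    · intro s hs a y hy
      rcases mul_eq_zero.1 (hD (s i) hs (a.map fun a => a i) (y i) hy) with h | h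
      · rw [agentOccupancy_some] at h
        have h2 := Finset.sum_eq_zero_iff.1 (Finset.sum_eq_zero_iff.1 h s (Finset.mem_univ _)) a
          (Finset.mem_univ _)
        rw [if_pos ⟨rfl, rfl⟩] at h2
        rw [h2, zero_mul]
      · have h2 := G.trans_le_trans_agent i s y a
        rw [h] at h2
        exact mul_eq_zero_of_right _ (le_antisymm h2 zero_le)

theorem stationaryEntropy_eq (hπ : π ∈ G.policies)
    (hfin : ∑' (s : ∀ i, S i) (a : Option (∀ i, A i)), G.joint.withEnd.occupancy π (some s) a ≠ ∞)
    (i : Fin N) : G.stationaryEntropy π i = ENNReal.ofReal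
      ((G.agent i).entropyFlow fun si ai => (G.agentOccupancy π i (some si) ai).toReal) := by
  have h := G.stationaryOccupancy_eq hfin i
  simp only [stationaryOccupancy] at h
  rw [stationaryEntropy, MDP.pathEntropy_ofStationary_eq (G.agentPolicy_none hπ i)]
  · simp_rw [h]
  · simp_rw [h]
    rwa [tsum_agentOccupancy]

end TeamGame

/-! ### Stopping at terminal states: length and value are linear in the occupancy measure. -/

/-- A sequence of states that stays in `some '' Fᶜ` until it reaches `some '' F`, and that equals
`none` afterwards. -/
theorem stopped_sequence {S : Type*} {F : Set S} {u : ℕ → Option S} (h0 : u 0 ≠ none)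
    (hF : ∀ t, u t ∈ some '' F → u (t + 1) = none)
    (hFc : ∀ t, u t ∉ some '' F → u t ≠ none → u (t + 1) ≠ none)
    (hnone : ∀ t, u t = none → ∀ k ≥ t, u k = none) :
    (∃ m, u m ∈ some '' F ∧ (∀ t < m, u t ≠ none ∧ u t ∉ some '' F) ∧ ∀ t > m, u t = none) ∨
      ∀ t, u t ≠ none ∧ u t ∉ some '' F := by
  classical
  have key (m : ℕ) (hm : ∀ t < m, u t ∉ some '' F) : ∀ t ≤ m, u t ≠ none := by
    intro t ht
    induction t with
    | zero => exact h0
    | succ t ih => exact hFc t (hm t ht) (ih (by omega))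
  by_cases h : ∃ m, u m ∈ some '' F
  · have hmin := fun t (ht : t < Nat.find h) => Nat.find_min h ht
    refine .inl ⟨Nat.find h, Nat.find_spec h, fun t ht => ⟨key _ hmin t ht.le, hmin t ht⟩, ?_⟩
    exact fun t ht => hnone _ (hF _ (Nat.find_spec h)) t ht
  · push Not at h
    exact .inr fun t => ⟨key t (fun k _ => h k) t le_rfl, h t⟩

namespace TeamGame

variable {N : ℕ} {S A : Fin N → Type*} [∀ i, Fintype (S i)] [∀ i, Fintype (A i)]
  (G : TeamGame S A) {π : Policy (Option (∀ i, S i)) (Option (∀ i, A i))}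

/-- Success from such a state fails already at time `0`. Hence the preprocessed game stops at every
avoid state, and the avoid condition in the value becomes automatic. -/
theorem avoid_diff_target_subset_dead : G.avoid \ G.target ⊆ G.dead := by
  rintro s ⟨hsA, hsT⟩
  refine ENNReal.iSup_eq_zero.2 fun π => ?_
  refine measure_mono_null ?_ (ae_iff.1 (MDP.ae_init ({ G.joint with init := s } : MDP _ _) π))
  rintro ξ ⟨m, hm, hlt⟩ h0
  change (ξ 0).state = s at h0
  cases m with
  | zero => exact hsT (h0 ▸ hm)
  | succ m => exact hlt 0 m.succ_pos (h0.symm ▸ hsA)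

theorem occupancy_none_of_notMem (hπ : π ∈ G.policies) {s : ∀ i, S i} (hs : s ∉ G.terminal) :
    G.joint.withEnd.occupancy π (some s) none = 0 :=
  MDP.occupancy_eq_zero _ _ fun n h => by
    rw [PMF.apply_eq_zero_iff]
    intro h1
    have : none = none ↔ s ∈ G.terminal := hπ n h (some s) h1
    exact hs (this.1 rfl)

theorem occupancy_some_of_mem (hπ : π ∈ G.policies) {s : ∀ i, S i} (hs : s ∈ G.terminal)
    (a : ∀ i, A i) : G.joint.withEnd.occupancy π (some s) (some a) = 0 :=
  MDP.occupancy_eq_zero _ _ fun n h => by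
    rw [PMF.apply_eq_zero_iff]
    intro h1
    have : some a = none ↔ s ∈ G.terminal := hπ n h (some s) h1
    simpa using this.2 hs

/-- Almost every path visits nonterminal states until it reaches a terminal state, and then the end
state. -/
theorem ae_stopped_sequence (hπ : π ∈ G.policies) :
    ∀ᵐ ξ ∂(G.joint.withEnd.pathLaw π),
      (∃ m, (ξ m).state ∈ some '' G.terminal ∧
        (∀ t < m, (ξ t).state ≠ none ∧ (ξ t).state ∉ some '' G.terminal) ∧
          ∀ t > m, (ξ t).state = none) ∨
      ∀ t, (ξ t).state ≠ none ∧ (ξ t).state ∉ some '' G.terminal := by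
  filter_upwards [G.joint.withEnd.ae_init π, G.joint.withEnd.ae_occupancy_ne_zero π,
    G.joint.withEnd.ae_trans_ne_zero π, MDP.ae_eq_endStep (M := G.joint) (G.policies_none hπ)]
    with ξ h0 hocc htrans hend
  refine stopped_sequence (u := fun t => (ξ t).state) (by simp [h0]) ?_ ?_ ?_
  · rintro t ⟨s, hs, hst⟩
    have h1 := hocc t
    have h2 := htrans t
    change some s = (ξ t).state at hst
    rw [← hst] at h1 h2
    cases ha : (ξ t).act with
    | none =>
      rw [ha, MDP.withEnd_trans_some_none] at h2
      by_contra hne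
      exact h2 (PMF.pure_apply_of_ne _ _ hne)
    | some a => exact absurd (G.occupancy_some_of_mem hπ hs a) (ha ▸ h1)
  · intro t hF hne hn
    have h1 := hocc t
    have h2 := htrans t
    change (ξ (t + 1)).state = none at hn
    obtain ⟨s, hs⟩ := Option.ne_none_iff_exists.1 hne
    rw [← hs] at h1 h2 hF
    cases ha : (ξ t).act with
    | none => exact absurd (G.occupancy_none_of_notMem hπ fun h => hF ⟨s, h, rfl⟩) (ha ▸ h1)
    | some a =>
      rw [ha, hn, MDP.withEnd_trans_some_some_none] at h2
      exact h2 rfl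
  · intro t ht k hk
    exact congrArg Step.state (hend t ht k hk)

/-- If the first terminal state occurs at time `m`, exactly `m + 1` steps precede the end state; if
there is none, both sides are infinite on that path. -/
theorem length_eq_tsum (hπ : π ∈ G.policies) :
    G.length π = ∑' (s : ∀ i, S i) (b : Option (∀ i, A i)),
      G.joint.withEnd.occupancy π (some s) b := by
  classical
  have h := G.joint.withEnd.lintegral_tsum_eval π fun x => if x.state = none then 0 else 1
  rw [ENNReal.tsum_option] at h
  simp only [if_true, mul_zero, tsum_zero, zero_add, reduceCtorEq, if_false, mul_one] at h
  rw [← h, length, MDP.expectedLength]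
  refine lintegral_congr_ae ?_
  filter_upwards [G.ae_stopped_sequence hπ] with ξ hξ
  rcases hξ with ⟨m, hm, hlt, hgt⟩ | hall
  · have h1 : ∑' t, (if (ξ t).state = none then (0 : ℝ≥0∞) else 1) = m + 1 := by
      rw [tsum_eq_sum (s := Finset.range (m + 1))]
      · rw [Finset.sum_congr rfl (g := fun _ => 1)]
        · simp
        · intro t ht
          rcases Nat.lt_succ_iff_lt_or_eq.1 (Finset.mem_range.1 ht) with h | rfl
          · simp [(hlt t h).1]
          · obtain ⟨s, _, hs⟩ := hm
            simp [← hs]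
      · intro t ht
        rw [if_pos (hgt t (by simpa using ht))]
    rw [h1]
    refine le_antisymm (iInf₂_le m hm) (le_iInf₂ fun t ht => ?_)
    have : m ≤ t := by
      by_contra hlt'
      exact (hlt t (not_le.1 hlt')).2 ht
    gcongr
  · simp [hall]

/-- A path meets the target at most once, so the probability of a visit is the expected number of
visits. -/
theorem value_eq_tsum (hπ : π ∈ G.policies) :
    G.value π = ∑' s : ∀ i, S i, G.target.indicator
      (fun s => ∑' b : Option (∀ i, A i), G.joint.withEnd.occupancy π (some s) b) s := by
  classical
  have h := G.joint.withEnd.lintegral_tsum_eval π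
    fun x => if x.state ∈ some '' G.target then 1 else 0
  rw [ENNReal.tsum_option] at h
  have hsum : ∑' s : ∀ i, S i, G.target.indicator
      (fun s => ∑' b : Option (∀ i, A i), G.joint.withEnd.occupancy π (some s) b) s =
      ∫⁻ ξ, ∑' t, (if (ξ t).state ∈ some '' G.target then 1 else 0)
        ∂(G.joint.withEnd.pathLaw π) := by
    rw [h]
    simp [Set.indicator_apply]
  have hTF : some '' G.target ⊆ some '' G.terminal := Set.image_mono Set.subset_union_left
  have hset : G.value π =
      G.joint.withEnd.pathLaw π {ξ | ∃ m, (ξ m).state ∈ some '' G.target} := by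
    refine measure_congr ?_
    filter_upwards [G.ae_stopped_sequence hπ] with ξ hξ
    refine propext ⟨fun ⟨m, hm, _⟩ => ⟨m, hm⟩, fun ⟨m, hm⟩ => ⟨m, hm, fun t ht hA => ?_⟩⟩
    have hnt : (ξ t).state ∉ some '' G.terminal := by
      rcases hξ with ⟨k, hk, hlt, hgt⟩ | hall
      · refine (hlt t (lt_of_lt_of_le ht ?_)).2
        by_contra hkm
        rw [hgt m (not_le.1 hkm)] at hm
        simp at hm
      · exact (hall t).2
    obtain ⟨s, hs, hst⟩ := hA
    rw [← hst] at hnt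
    have hsF : s ∉ G.terminal := fun h => hnt ⟨s, h, rfl⟩
    exact hsF (.inr (G.avoid_diff_target_subset_dead ⟨hs, fun h => hsF (.inl h)⟩))
  have hmeas : MeasurableSet {ξ : ℕ → Step (Option (∀ i, S i)) (Option (∀ i, A i)) |
      ∃ m, (ξ m).state ∈ some '' G.target} := by
    have : {ξ : ℕ → Step (Option (∀ i, S i)) (Option (∀ i, A i)) |
        ∃ m, (ξ m).state ∈ some '' G.target} = ⋃ m, {ξ | (ξ m).state ∈ some '' G.target} := by
      ext ξ
      simp
    rw [this]
    exact MeasurableSet.iUnion fun m => MDP.measurableSet_eval m fun x =>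
      x.state ∈ some '' G.target
  rw [hsum, hset, ← lintegral_indicator_one hmeas]
  refine lintegral_congr_ae ?_
  filter_upwards [G.ae_stopped_sequence hπ] with ξ hξ
  rcases hξ with ⟨m, hm, hlt, hgt⟩ | hall
  · have hne (t : ℕ) (ht : t ≠ m) : (ξ t).state ∉ some '' G.target := by
      rcases lt_or_gt_of_ne ht with h | h
      · exact fun h' => (hlt t h).2 (hTF h')
      · rw [hgt t h]
        simp
    rw [tsum_eq_single m fun t ht => if_neg (hne t ht), Set.indicator_apply]
    have : (∃ k, (ξ k).state ∈ some '' G.target) ↔ (ξ m).state ∈ some '' G.target := by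
      refine ⟨fun ⟨k, hk⟩ => ?_, fun h => ⟨m, h⟩⟩
      by_contra hkm
      refine hne k ?_ hk
      rintro rfl
      exact hkm hk
    exact if_congr this rfl rfl
  · have hne (t : ℕ) : (ξ t).state ∉ some '' G.target := fun h => (hall t).2 (hTF h)
    rw [Set.indicator_of_notMem (by rintro ⟨k, hk⟩; exact hne k hk)]
    simp only [hne, if_false, tsum_zero]

/-- A bound on the occupancy measures at all states from a bound at the nonterminal states. -/
theorem tsum_occupancy_le {K : ℝ≥0} (hK : ∀ π ∈ G.policies, ∀ s ∉ G.terminal,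
      ∑' a : ∀ i, A i, G.preprocessed.occupancy π (some s) (some a) ≤ K)
    (hπ : π ∈ G.policies) (y : ∀ i, S i) :
    ∑' b : Option (∀ i, A i), G.joint.withEnd.occupancy π (some y) b ≤
      ((1 + ∑ _s : ∀ i, S i, K : ℝ≥0) : ℝ≥0∞) := by
  classical
  -- The bound is `1` for the source plus `K` per state: terminal states only play `ε`, which leads
  -- to the end state, and a nonterminal state sends out at most `K`.
  rw [G.joint.isFlow_occupancy π y]
  push_cast
  gcongr
  · by_cases h : y = G.joint.init <;> simp [h]
  · rw [tsum_fintype]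
    refine Finset.sum_le_sum fun s _ => ?_
    rw [ENNReal.tsum_option, MDP.withEnd_trans_some_none, PMF.pure_apply_of_ne _ _ (by simp),
      mul_zero, zero_add]
    by_cases hs : s ∈ G.terminal
    · simp [G.occupancy_some_of_mem hπ hs]
    · refine le_trans (ENNReal.tsum_le_tsum fun a => ?_) (hK π hπ s hs)
      exact mul_le_of_le_one_right' (PMF.coe_le_one _ _)

end TeamGame

/-! ### The objective as a continuous function on a compact polytope of flows. -/

namespace TeamGame

variable {N : ℕ} {S A : Fin N → Type*} [∀ i, Fintype (S i)] [∀ i, Fintype (A i)]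
  (G : TeamGame S A) {π : Policy (Option (∀ i, S i)) (Option (∀ i, A i))}

/-- The real-valued occupancy measure of the preprocessed joint game. -/
def flow (π : Policy (Option (∀ i, S i)) (Option (∀ i, A i))) (s : ∀ i, S i)
    (b : Option (∀ i, A i)) : ℝ :=
  (G.joint.withEnd.occupancy π (some s) b).toReal

open Classical in
/-- The marginal of a joint flow for agent `i`. -/
def agentMarginal (i : Fin N) (x : (∀ i, S i) → Option (∀ i, A i) → ℝ) (si : S i)
    (ai : Option (A i)) : ℝ :=
  ∑ s with s i = si, ∑ a with a.map (fun a => a i) = ai, x s a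

open Classical in
/-- The objective as a function of the occupancy measure of a stationary policy. -/
def objectiveFlow (δ β : ℝ) (x : (∀ i, S i) → Option (∀ i, A i) → ℝ) : ℝ :=
  ∑ s with s ∈ G.target, ∑ b, x s b - δ * ∑ s, ∑ b, x s b -
    β * (∑ i, (G.agent i).entropyFlow (agentMarginal i x) - G.joint.entropyFlow x)

theorem continuous_objectiveFlow (δ β : ℝ) : Continuous (G.objectiveFlow δ β) := by
  have h1 (i : Fin N) : Continuous (agentMarginal (S := S) (A := A) i) := by
    unfold agentMarginal
    fun_prop
  have h2 (i : Fin N) := ((G.agent i).continuous_entropyFlow).comp (h1 i)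
  have h3 := G.joint.continuous_entropyFlow
  unfold objectiveFlow
  simp only [Function.comp_def] at h2
  fun_prop

theorem toReal_agentOccupancy
    (hocc : ∀ s b, G.joint.withEnd.occupancy π (some s) b ≠ ∞) (i : Fin N) (si : S i)
    (ai : Option (A i)) :
    (G.agentOccupancy π i (some si) ai).toReal = agentMarginal i (G.flow π) si ai := by
  classical
  rw [agentOccupancy_some, agentMarginal, ENNReal.toReal_sum, Finset.sum_filter]
  · refine Finset.sum_congr rfl fun s _ => ?_
    rw [ENNReal.toReal_sum]
    · split_ifs with h
      · rw [Finset.sum_filter]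
        refine Finset.sum_congr rfl fun a _ => ?_
        by_cases ha : a.map (fun a => a i) = ai <;> simp [h, ha, flow]
      · simp [h]
    · intro a _
      split_ifs
      exacts [hocc s a, ENNReal.zero_ne_top]
  · intro s _
    refine ENNReal.sum_ne_top.2 fun a _ => ?_
    split_ifs
    exacts [hocc s a, ENNReal.zero_ne_top]

/-- Only the joint entropy can deviate from its flow formula: the agents' processes are stationary
by construction. The joint entropy enters the objective with the sign `+β`, so the deviation only
lowers the objective when `β ≥ 0`. -/
theorem objective_eq_sub (hπ : π ∈ G.policies) (δ β : ℝ)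
    (hfin : ∑' (s : ∀ i, S i) (a : Option (∀ i, A i)),
      G.joint.withEnd.occupancy π (some s) a ≠ ∞) :
    G.objective δ β π = G.objectiveFlow δ β (G.flow π) -
      β * (G.joint.entropyFlow (G.flow π) - (G.jointEntropy π).toReal) := by
  classical
  have hocc (s : ∀ i, S i) (b : Option (∀ i, A i)) :
      G.joint.withEnd.occupancy π (some s) b ≠ ∞ :=
    ENNReal.ne_top_of_tsum_ne_top (ENNReal.ne_top_of_tsum_ne_top hfin s) b
  have hrow (s : ∀ i, S i) : (∑' b, G.joint.withEnd.occupancy π (some s) b).toReal =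
      ∑ b, G.flow π s b := by
    rw [tsum_fintype, ENNReal.toReal_sum fun b _ => hocc s b]
    rfl
  have hrowfin (s : ∀ i, S i) : ∑' b, G.joint.withEnd.occupancy π (some s) b ≠ ∞ :=
    ENNReal.ne_top_of_tsum_ne_top hfin s
  have hv : (G.value π).toReal = ∑ s with s ∈ G.target, ∑ b, G.flow π s b := by
    rw [G.value_eq_tsum hπ, tsum_fintype, ENNReal.toReal_sum, Finset.sum_filter]
    · refine Finset.sum_congr rfl fun s _ => ?_
      by_cases hs : s ∈ G.target
      · rw [Set.indicator_of_mem hs, if_pos hs, hrow]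
      · rw [Set.indicator_of_notMem hs, if_neg hs, ENNReal.toReal_zero]
    · intro s _
      by_cases hs : s ∈ G.target <;> simp only [hs, Set.indicator_of_mem,
        Set.indicator_of_notMem, not_false_eq_true]
      exacts [hrowfin s, ENNReal.zero_ne_top]
  have hl : (G.length π).toReal = ∑ s, ∑ b, G.flow π s b := by
    rw [G.length_eq_tsum hπ, tsum_fintype, ENNReal.toReal_sum fun s _ => hrowfin s]
    exact Finset.sum_congr rfl fun s _ => hrow s
  have hH (i : Fin N) : (G.stationaryEntropy π i).toReal =
      (G.agent i).entropyFlow (agentMarginal i (G.flow π)) := by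
    rw [G.stationaryEntropy_eq hπ hfin, ENNReal.toReal_ofReal]
    · simp_rw [G.toReal_agentOccupancy hocc]
    · exact MDP.entropyFlow_nonneg fun _ _ => ENNReal.toReal_nonneg
  rw [objective, totalCorrelationBound, hv, hl, objectiveFlow, Finset.sum_congr rfl fun i _ => hH i]
  ring

theorem jointEntropy_le (hπ : π ∈ G.policies)
    (hfin : ∑' (s : ∀ i, S i) (a : Option (∀ i, A i)),
      G.joint.withEnd.occupancy π (some s) a ≠ ∞) :
    G.jointEntropy π ≤ ENNReal.ofReal (G.joint.entropyFlow (G.flow π)) :=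
  MDP.pathEntropy_le (G.policies_none hπ) hfin

theorem objective_le (hπ : π ∈ G.policies) (δ : ℝ) {β : ℝ} (hβ : 0 ≤ β)
    (hfin : ∑' (s : ∀ i, S i) (a : Option (∀ i, A i)),
      G.joint.withEnd.occupancy π (some s) a ≠ ∞) :
    G.objective δ β π ≤ G.objectiveFlow δ β (G.flow π) := by
  rw [G.objective_eq_sub hπ δ β hfin]
  have h : (G.jointEntropy π).toReal ≤ G.joint.entropyFlow (G.flow π) :=
    ENNReal.toReal_le_of_le_ofReal (MDP.entropyFlow_nonneg fun _ _ => ENNReal.toReal_nonneg)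
      (G.jointEntropy_le hπ hfin)
  have := mul_nonneg hβ (sub_nonneg.2 h)
  linarith

theorem objective_ofStationary {ρ : Option (∀ i, S i) → PMF (Option (∀ i, A i))}
    (hρ : Policy.ofStationary ρ ∈ G.policies) (δ β : ℝ)
    (hfin : ∑' (s : ∀ i, S i) (a : Option (∀ i, A i)),
      G.joint.withEnd.occupancy (.ofStationary ρ) (some s) a ≠ ∞) :
    G.objective δ β (.ofStationary ρ) = G.objectiveFlow δ β (G.flow (.ofStationary ρ)) := by
  have h : G.jointEntropy (.ofStationary ρ) =
      ENNReal.ofReal (G.joint.entropyFlow (G.flow (.ofStationary ρ))) :=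
    MDP.pathEntropy_ofStationary_eq (G.policies_none hρ 0 Fin.elim0) hfin
  rw [G.objective_eq_sub hρ δ β hfin, h, ENNReal.toReal_ofReal]
  · ring
  · exact MDP.entropyFlow_nonneg fun _ _ => ENNReal.toReal_nonneg

/-- A set of states that contains the initial state and that no action leaves before the game
ends. -/
def IsInvariant (U : Set (∀ i, S i)) : Prop :=
  G.joint.init ∈ U ∧
    ∀ s ∈ U, s ∉ G.terminal → ∀ a y, G.joint.trans s a y ≠ 0 → y ∈ U

/-- The flows on the available actions that are bounded by `B` and vanish on the unreachable
states. -/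
def flowPolytope (B : ℝ) : Set ((∀ i, S i) → Option (∀ i, A i) → ℝ) :=
  {x | (∀ s b, x s b ∈ Set.Icc 0 B) ∧
    (∀ y, ∑ b, x y b = ({G.joint.init} : Set (∀ i, S i)).indicator 1 y +
      ∑ s, ∑ b, x s b * (G.joint.withEnd.trans (some s) b (some y)).toReal) ∧
    (∀ s b, b ∉ G.avail (some s) → x s b = 0) ∧
    ∀ U, G.IsInvariant U → ∀ s ∉ U, ∀ b, x s b = 0}

/-- Unreachability is encoded by linear equations, one family for each invariant set, so it is a
closed condition. -/
theorem isCompact_flowPolytope (B : ℝ) : IsCompact (G.flowPolytope B) := by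
  have h1 : IsCompact (Set.univ.pi fun _ : ∀ i, S i =>
      Set.univ.pi fun _ : Option (∀ i, A i) => Set.Icc (0 : ℝ) B) :=
    isCompact_univ_pi fun _ => isCompact_univ_pi fun _ => isCompact_Icc
  refine h1.of_isClosed_subset ?_ fun x hx => ?_
  · simp only [flowPolytope, Set.ofPred_and, Set.ofPred_forall]
    refine IsClosed.inter ?_ (IsClosed.inter ?_ (IsClosed.inter ?_ ?_))
    · exact isClosed_iInter fun s => isClosed_iInter fun b =>
        isClosed_Icc.preimage (by fun_prop)
    · exact isClosed_iInter fun y => isClosed_eq (by fun_prop) (by fun_prop)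
    · exact isClosed_iInter fun s => isClosed_iInter fun b => isClosed_iInter fun _ =>
        isClosed_eq (by fun_prop) (by fun_prop)
    · exact isClosed_iInter fun U => isClosed_iInter fun _ => isClosed_iInter fun s =>
        isClosed_iInter fun _ => isClosed_iInter fun b =>
          isClosed_eq (by fun_prop) (by fun_prop)
  · exact fun s _ b _ => hx.1 s b

theorem occupancy_eq_zero_of_notMem_avail (hπ : π ∈ G.policies) {s : ∀ i, S i}
    {b : Option (∀ i, A i)} (hb : b ∉ G.avail (some s)) :
    G.joint.withEnd.occupancy π (some s) b = 0 :=
  MDP.occupancy_eq_zero _ _ fun n h => by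
    rw [PMF.apply_eq_zero_iff]
    exact fun h1 => hb (hπ n h (some s) h1)

theorem flow_mem_flowPolytope (hπ : π ∈ G.policies) {B : ℝ≥0}
    (hB : ∀ s : ∀ i, S i, ∑' b, G.joint.withEnd.occupancy π (some s) b ≤ B) :
    G.flow π ∈ G.flowPolytope B := by
  classical
  have hocc (s : ∀ i, S i) (b : Option (∀ i, A i)) :
      G.joint.withEnd.occupancy π (some s) b ≤ B := (ENNReal.le_tsum b).trans (hB s)
  have hoccfin (s : ∀ i, S i) (b : Option (∀ i, A i)) :
      G.joint.withEnd.occupancy π (some s) b ≠ ∞ :=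
    ne_top_of_le_ne_top ENNReal.coe_ne_top (hocc s b)
  refine ⟨fun s b => ⟨ENNReal.toReal_nonneg, ?_⟩, fun y => ?_, fun s b hb => ?_,
    fun U hU s hs b => ?_⟩
  · exact ENNReal.toReal_le_of_le_ofReal B.coe_nonneg (by simpa using hocc s b)
  · have h := G.joint.isFlow_occupancy π y
    simp_rw [tsum_fintype] at h
    have hterm (s : ∀ i, S i) (b : Option (∀ i, A i)) : G.joint.withEnd.occupancy π (some s) b *
        G.joint.withEnd.trans (some s) b (some y) ≠ ∞ :=
      ENNReal.mul_ne_top (hoccfin s b) (PMF.apply_ne_top _ _)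
    have h2 := congrArg ENNReal.toReal h
    rw [ENNReal.toReal_sum fun b _ => hoccfin y b, ENNReal.toReal_add, ENNReal.toReal_sum] at h2
    · refine h2.trans ?_
      congr 1
      · by_cases hy : y = G.joint.init <;> simp [hy]
      · refine Finset.sum_congr rfl fun s _ => ?_
        rw [ENNReal.toReal_sum fun b _ => hterm s b]
        simp_rw [ENNReal.toReal_mul]
        rfl
    · exact fun s _ => ENNReal.sum_ne_top.2 fun b _ => hterm s b
    · by_cases hy : y = G.joint.init <;> simp [hy]
    · exact ENNReal.sum_ne_top.2 fun s _ => ENNReal.sum_ne_top.2 fun b _ => hterm s b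
  · rw [flow, G.occupancy_eq_zero_of_notMem_avail hπ hb, ENNReal.toReal_zero]
  -- The complement of an invariant set has no inflow: no original action leaves `U` from a
  -- nonterminal state, and terminal states pass only to the end state.
  · rw [flow, G.joint.occupancy_eq_zero_of_no_inflow π (D := Uᶜ) (fun h => h hU.1) ?_ s hs b,
      ENNReal.toReal_zero]
    intro s hs b y hy
    rw [Set.mem_compl_iff, not_not] at hs
    rw [mul_eq_zero]
    cases b with
    | none => exact .inr (by simp)
    | some a =>
      rw [MDP.withEnd_trans_some_some]
      by_cases hsF : s ∈ G.terminal
      · exact .inl (G.occupancy_some_of_mem hπ hsF a)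
      · right
        by_contra hne
        exact hy (hU.2 s hs hsF a y hne)

/-! ### Every point of the polytope comes from a stationary policy. -/

section Realization

variable [∀ i, Nonempty (A i)]

open Classical in
/-- A stationary policy that explores all actions outside of `D` and follows `ρ` in `D`. -/
def explorePolicy (D : Set (∀ i, S i)) (ρ : Option (∀ i, S i) → PMF (Option (∀ i, A i))) :
    Option (∀ i, S i) → PMF (Option (∀ i, A i))
  | none => PMF.pure none
  | some s => if s ∈ D then ρ (some s) else if s ∈ G.terminal then PMF.pure none else
      (PMF.uniformOfFintype (∀ i, A i)).map some

theorem explorePolicy_mem (D : Set (∀ i, S i))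
    {ρ : Option (∀ i, S i) → PMF (Option (∀ i, A i))} (hρ : Policy.ofStationary ρ ∈ G.policies) :
    Policy.ofStationary (G.explorePolicy D ρ) ∈ G.policies := by
  intro n h s
  cases s with
  | none => simp [Policy.ofStationary, explorePolicy, avail]
  | some s =>
    simp only [Policy.ofStationary, explorePolicy]
    split_ifs with h1 h2
    · exact hρ n h (some s)
    · simp [avail, h2]
    · intro b hb
      obtain ⟨a, _, rfl⟩ := (PMF.mem_support_map_iff _ _ _).1 hb
      simp [avail, h2]

theorem policies_nonempty : G.policies.Nonempty := by
  classical
  refine ⟨.ofStationary (G.explorePolicy ∅ fun _ => PMF.pure none), fun n h s => ?_⟩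
  cases s with
  | none => simp [Policy.ofStationary, explorePolicy, avail]
  | some s =>
    simp only [Policy.ofStationary, explorePolicy, Set.mem_empty_iff_false, if_false]
    split_ifs with h2
    · simp [avail, h2]
    · intro b hb
      obtain ⟨a, _, rfl⟩ := (PMF.mem_support_map_iff _ _ _).1 hb
      simp [avail, h2]

/-- If all policies have finite occupancy measures, then a set of nonterminal states that a
stationary policy never leaves is unreachable. -/
theorem exists_isInvariant_disjoint
    (hfin : ∀ π ∈ G.policies, ∑' (s : ∀ i, S i) (a : Option (∀ i, A i)),
      G.joint.withEnd.occupancy π (some s) a ≠ ∞)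
    {ρ : Option (∀ i, S i) → PMF (Option (∀ i, A i))} (hρ : Policy.ofStationary ρ ∈ G.policies)
    {D : Set (∀ i, S i)} (hD : ∀ s ∈ D, ∀ b, ρ (some s) b ≠ 0 →
      ∑' y, D.indicator (fun y => G.joint.withEnd.trans (some s) b (some y)) y = 1) :
    ∃ U, G.IsInvariant U ∧ Disjoint D U := by
  classical
  set σ := G.explorePolicy D ρ with hσ
  have hσmem := G.explorePolicy_mem D hρ
  set x : (∀ i, S i) → Option (∀ i, A i) → ℝ≥0∞ :=
    fun s b => G.joint.withEnd.occupancy (.ofStationary σ) (some s) b with hx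
  have hflow : G.joint.IsFlow x := G.joint.isFlow_occupancy _
  have hxσ (s : ∀ i, S i) (b : Option (∀ i, A i)) : x s b = (∑' c, x s c) * σ (some s) b :=
    G.joint.withEnd.occupancy_ofStationary σ _ _
  -- Under `σ` the set `D` is closed. Finite occupancy therefore leaves no way into it, even though
  -- `σ` tries all actions outside of `D`.
  obtain ⟨h0, hin⟩ := hflow.no_inflow (hfin _ hσmem) (D := D) fun s hs b hb => hD s hs b fun h => by
    rw [hxσ, hσ, explorePolicy, if_pos hs, h, mul_zero] at hb
    exact hb rfl
  -- The states visited by `σ` outside of `D`. They are invariant because `σ` gives every original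
  -- action positive probability at the nonterminal ones.
  refine ⟨{s | s ∉ D ∧ ∑' b, x s b ≠ 0}, ⟨⟨h0, ?_⟩, ?_⟩, ?_⟩
  · rw [hflow]
    simp
  · rintro s ⟨hsD, hs⟩ hsF a y hy
    have hsa : x s (some a) ≠ 0 := by
      rw [hxσ, hσ, explorePolicy, if_neg hsD, if_neg hsF]
      refine mul_ne_zero hs ?_
      rw [← PMF.mem_support_iff, PMF.mem_support_map_iff]
      exact ⟨a, by simp, rfl⟩
    have hprod : x s (some a) * G.joint.withEnd.trans (some s) (some a) (some y) ≠ 0 := by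
      rw [MDP.withEnd_trans_some_some]
      exact mul_ne_zero hsa hy
    refine ⟨fun hyD => hprod (hin s hsD _ y hyD), fun h => ?_⟩
    rw [hflow, add_eq_zero] at h
    exact hprod (ENNReal.tsum_eq_zero.1 (ENNReal.tsum_eq_zero.1 h.2 s) (some a))
  · exact Set.disjoint_left.2 fun s hs hs' => hs'.1 hs

/-- The points of the flow polytope are the occupancy measures of the stationary policies. -/
theorem exists_flow_ofStationary_eq
    (hfin : ∀ π ∈ G.policies, ∑' (s : ∀ i, S i) (a : Option (∀ i, A i)),
      G.joint.withEnd.occupancy π (some s) a ≠ ∞)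
    {B : ℝ} {x : (∀ i, S i) → Option (∀ i, A i) → ℝ} (hx : x ∈ G.flowPolytope B) :
    ∃ ρ : Option (∀ i, S i) → PMF (Option (∀ i, A i)),
      Policy.ofStationary ρ ∈ G.policies ∧ G.flow (.ofStationary ρ) = x := by
  classical
  obtain ⟨hbox, hflow, havail, hU⟩ := hx
  set z : (∀ i, S i) → Option (∀ i, A i) → ℝ≥0∞ := fun s b => ENNReal.ofReal (x s b) with hz
  have hzrow (s : ∀ i, S i) : ∑' b, z s b = ENNReal.ofReal (∑ b, x s b) := by
    rw [tsum_fintype, ENNReal.ofReal_sum_of_nonneg fun b _ => (hbox s b).1]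
  have hzfin : ∑' (s : ∀ i, S i) (b : Option (∀ i, A i)), z s b ≠ ∞ := by
    simp_rw [hzrow]
    rw [tsum_fintype]
    exact ENNReal.sum_ne_top.2 fun s _ => ENNReal.ofReal_ne_top
  have hzflow : G.joint.IsFlow z := by
    intro y
    rw [hzrow, hflow, ENNReal.ofReal_add]
    · congr 1
      · by_cases hy : y = G.joint.init <;> simp [hy]
      · rw [ENNReal.ofReal_sum_of_nonneg, tsum_fintype]
        · refine Finset.sum_congr rfl fun s _ => ?_
          rw [ENNReal.ofReal_sum_of_nonneg, tsum_fintype]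
          · refine Finset.sum_congr rfl fun b _ => ?_
            rw [ENNReal.ofReal_mul (hbox s b).1, ENNReal.ofReal_toReal (PMF.apply_ne_top _ _)]
          · exact fun b _ => mul_nonneg (hbox s b).1 ENNReal.toReal_nonneg
        · exact fun s _ => Finset.sum_nonneg fun b _ =>
            mul_nonneg (hbox s b).1 ENNReal.toReal_nonneg
    · exact Set.indicator_nonneg (fun _ _ => zero_le_one) _
    · exact Finset.sum_nonneg fun s _ => Finset.sum_nonneg fun b _ =>
        mul_nonneg (hbox s b).1 ENNReal.toReal_nonneg
  -- `π₀` only supplies available actions at states where `x` has no mass.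
  obtain ⟨π₀, hπ₀⟩ := G.policies_nonempty
  set ρ := MDP.proportionalPolicy z fun s => π₀ 0 Fin.elim0 (some s) with hρdef
  have hρ : Policy.ofStationary ρ ∈ G.policies := by
    intro n h s
    cases s with
    | none => simp [Policy.ofStationary, hρdef, MDP.proportionalPolicy, avail]
    | some s =>
      simp only [Policy.ofStationary, hρdef, MDP.proportionalPolicy]
      split_ifs with h1
      · intro b hb
        rw [PMF.support_normalize] at hb
        by_contra hne
        exact hb (by simp [hz, havail s b hne])
      · exact hπ₀ 0 Fin.elim0 (some s)
  -- A closed set `D` of `ρ` misses some invariant `U`, and `x` vanishes off `U`; this excludes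
  -- spurious circulations.
  have hocc := hzflow.occupancy_eq hzfin (ρ := ρ)
    (fun s b => MDP.proportionalPolicy_spec z _ s (ENNReal.ne_top_of_tsum_ne_top hzfin s) b)
    fun D hD _ _ s hs b => by
      obtain ⟨U, hUinv, hDU⟩ := G.exists_isInvariant_disjoint hfin hρ hD
      simp [hz, hU U hUinv s (Set.disjoint_left.1 hDU hs) b]
  refine ⟨ρ, hρ, ?_⟩
  ext s b
  rw [flow, hocc, ENNReal.toReal_ofReal (hbox s b).1]

end Realization

end TeamGame

/-! ### Existence of an optimal stationary policy. -/

theorem mainTheorem7 {N : ℕ} {S A : Fin N → Type*} [∀ i, Fintype (S i)] [∀ i, Fintype (A i)]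
    [∀ i, Nonempty (A i)] (G : TeamGame S A) (δ β : ℝ) (hδ : 0 < δ) (hβ : 0 < β)
    (hK : ∃ K : ℝ≥0, ∀ π ∈ G.policies, ∀ s ∉ G.terminal,
      ∑' a : ∀ i, A i, G.preprocessed.occupancy π (some s) (some a) ≤ K) :
    (∀ π ∈ G.policies, G.length π ≠ ∞ ∧ G.jointEntropy π ≠ ∞ ∧
      ∀ i, G.stationaryEntropy π i ≠ ∞ ∧
        ∀ si ai, G.stationaryOccupancy π i (some si) ai = G.agentOccupancy π i (some si) ai) ∧
    ∃ ρ : Option (∀ i, S i) → PMF (Option (∀ i, A i)),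
      Policy.ofStationary ρ ∈ G.policies ∧
      IsGreatest (G.objective δ β '' G.policies) (G.objective δ β (Policy.ofStationary ρ)) := by
  classical
  obtain ⟨K, hK⟩ := hK
  have hB := fun π (hπ : π ∈ G.policies) => G.tsum_occupancy_le hK hπ
  have hfin : ∀ π ∈ G.policies, ∑' (s : ∀ i, S i) (a : Option (∀ i, A i)),
      G.joint.withEnd.occupancy π (some s) a ≠ ∞ := fun π hπ => by
    rw [tsum_fintype]
    exact ENNReal.sum_ne_top.2 fun s _ => ne_top_of_le_ne_top ENNReal.coe_ne_top (hB π hπ s)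
  refine ⟨fun π hπ => ⟨?_, ?_, fun i => ⟨?_, G.stationaryOccupancy_eq (hfin π hπ) i⟩⟩, ?_⟩
  · rw [G.length_eq_tsum hπ]
    exact hfin π hπ
  · exact ne_top_of_le_ne_top ENNReal.ofReal_ne_top (G.jointEntropy_le hπ (hfin π hπ))
  · rw [G.stationaryEntropy_eq hπ (hfin π hπ)]
    exact ENNReal.ofReal_ne_top
  · have hmem := fun π (hπ : π ∈ G.policies) => G.flow_mem_flowPolytope hπ (hB π hπ)
    obtain ⟨π₀, hπ₀⟩ := G.policies_nonempty
    -- The maximizer of the upper bound `objectiveFlow` is the flow of a stationary policy, for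
    -- which the bound is attained.
    obtain ⟨x, hx, hmax⟩ := (G.isCompact_flowPolytope _).exists_isMaxOn ⟨_, hmem π₀ hπ₀⟩
      (G.continuous_objectiveFlow δ β).continuousOn
    obtain ⟨ρ, hρ, rfl⟩ := G.exists_flow_ofStationary_eq hfin hx
    refine ⟨ρ, hρ, ⟨_, hρ, rfl⟩, ?_⟩
    rintro _ ⟨π, hπ, rfl⟩
    rw [G.objective_ofStationary hρ δ β (hfin _ hρ)]
    exact (G.objective_le hπ δ hβ.le (hfin π hπ)).trans (hmax (hmem π hπ))

end
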